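/- Let $f\in L^1[0,1]$ (real- or complex-valued) and let $G\subset[0,1]$ be an everywhere dense (relatively) open set. (1) There is a function $g\in L^1[0,1]$ with $\{x\in[0,1]: g(x)\neq f(x)\}\subset G$ whose Fourier series in the Walsh system (in the Paley ordering: $w_n(x)=\prod_k r_k(x)^{n_k}$ for $n=\sum_k n_k2^k$, $n_k\in\{0,1\}$, where $r_k$ are the Rademacher functions) converges to $g$ almost everywhere on $[0,1]$. (2) The same holds for every Vilenkin system of bounded type: given integers $p_k\ge 2$, $k=0,1,2,\ldots$, with $\sup_k p_k<\infty$, put $P_0=1$, $P_{k+1}=p_kP_k$, and $$\psi_n(x)=\prod_{k}\exp\left(2\pi i\,\frac{n_kx_k}{p_k}\right),\qquad n=\sum_k n_kP_k,\quad x=\sum_k\frac{x_k}{P_{k+1}}\in[0,1),\quad n_k,x_k\in\{0,\ldots,p_k-1\},$$ where for $x$ with two such expansions the finite one is taken. Then there is a function $g\in L^1[0,1]$ with $\{x\in[0,1]: g(x)\neq f(x)\}\subset G$ such that the partial sums $\sum_{n<N}c_n(g)\psi_n(x)$, $c_n(g)=\int_0^1 g\,\overline{\psi_n}$, converge to $g(x)$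 for almost every $x\in[0,1]$ as $N\to\infty$. In both cases, $g$ can be taken real-valued if $f$ is real-valued. -/

import Mathlib

open MeasureTheory Filter Topology

noncomputable section

/-- The Rademacher function `r k` on `[0,1]`: `r 0` is `1` on `[0,1/2)` and `-1` on `[1/2,1)`,
continued periodically with period `1`, and `r k x = r 0 (2 ^ k * x)`. -/
def rademacher (k : ℕ) (x : unitInterval) : ℝ :=
  (-1) ^ ⌊(2 : ℝ) ^ (k + 1) * (x : ℝ)⌋₊

/-- The Walsh system in the Paley ordering: if `n = ∑ k, n_k * 2 ^ k` with `n_k ∈ {0, 1}`, then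
`walsh n = ∏ k, (rademacher k) ^ n_k`. The factors with `k ≥ n` have exponent `0`. -/
def walsh (n : ℕ) (x : unitInterval) : ℂ :=
  ((∏ k ∈ Finset.range n, rademacher k x ^ (n / 2 ^ k % 2) : ℝ) : ℂ)

/-- The generalized powers `P 0 = 1`, `P k = p 0 * p 1 * ⋯ * p (k - 1)`. -/
def vilenkinPow (p : ℕ → ℕ) (k : ℕ) : ℕ :=
  ∏ j ∈ Finset.range k, p j

/-- The digit `x_k ∈ {0, …, p k - 1}` in the expansion `x = ∑ k, x_k / P (k + 1)` of a point
`x ∈ [0,1)` (the finite expansion if there are two). -/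
def vilenkinDigit (p : ℕ → ℕ) (k : ℕ) (x : unitInterval) : ℕ :=
  ⌊(vilenkinPow p (k + 1) : ℝ) * (x : ℝ)⌋₊ % p k

/-- The generalized Rademacher function `x ↦ exp (2 π i x_k / p k)`. -/
def vilenkinRademacher (p : ℕ → ℕ) (k : ℕ) (x : unitInterval) : ℂ :=
  Complex.exp (2 * Real.pi * Complex.I * (vilenkinDigit p k x : ℂ) / (p k : ℂ))

/-- The Vilenkin system generated by `p 0, p 1, … ≥ 2`: if `n = ∑ k, n_k * P k` with
`n_k ∈ {0, …, p k - 1}`, then `vilenkin p n = ∏ k, (vilenkinRademacher p k) ^ n_k`.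
The factors with `k ≥ n` have exponent `0`, since `P k ≥ 2 ^ k > n` for these. -/
def vilenkin (p : ℕ → ℕ) (n : ℕ) (x : unitInterval) : ℂ :=
  ∏ k ∈ Finset.range n, vilenkinRademacher p k x ^ (n / vilenkinPow p k % p k)

/-- The `n`-th Fourier coefficient of `g` with respect to a system `φ` on `[0,1]`. -/
def systemCoeff (φ : ℕ → unitInterval → ℂ) (g : unitInterval → ℂ) (n : ℕ) : ℂ :=
  ∫ t, g t * (starRingEnd ℂ) (φ n t)

/-- The `N`-th partial sum of the Fourier series of `g` with respect to `φ`. -/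
def systemPartialSum (φ : ℕ → unitInterval → ℂ) (g : unitInterval → ℂ) (N : ℕ)
    (x : unitInterval) : ℂ :=
  ∑ n ∈ Finset.range N, systemCoeff φ g n * φ n x

/-- The Fourier series of `g` with respect to `φ` converges to `g` almost everywhere. -/
def FourierSeriesConvergesAE (φ : ℕ → unitInterval → ℂ) (g : unitInterval → ℂ) : Prop :=
  ∀ᵐ x : unitInterval, Tendsto (fun N => systemPartialSum φ g N x) atTop (𝓝 (g x))

end

namespace Vilenkin

/-! Expand `f` as a series of terms `a_i 1_{I_i}` with `I_i` an interval of level `m_i` and `∑ |a_i|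
|I_i| < ∞` (`exists_hasSum_indicator_block`). Replace each term by the atom `a_i 1_{I_i} (1 - h_i)`,
where `h_i` (`comb`) is a multiple of the indicator of a periodic family of tiny intervals lying in
`G` up to the point `1` (`exists_block_subset`), with mean `1` on every interval of level `s_i`. The
mean condition kills all coefficients below `P_{s_i}`; since the atom depends only on the first
`t_i` digits, those from `P_{t_i}` on vanish too. Its `L¹` norm is at most `2 |a_i| |I_i|`. Choosing
`s_{i+1} ≥ t_i` makes the spectra consecutive, and the sum `g` of the atoms is integrable and agrees
with `f` almost everywhere off `G`.

A partial sum of the Fourier series of `g` consists of complete atoms and a partial sum of at most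
one further atom. The complete ones add up to a partial sum of a series converging to `g`, so only
the incomplete one matters. No maximal theorem for general functions is needed: writing `N = q P_s +
r`, the partial sum of an atom is governed by two kernels with fixed second arguments
(`systemPartialSum_mul_comb`, `norm_systemPartialSum_atom_le`). Such a kernel is large only near its
pole (`exists_block_of_lt_norm_kernel`), which gives a weak type bound `C |a_i| |I_i| / c`
(`volume_maximal_atom_le`). These bounds are summable, so Borel–Cantelli makes the incomplete part
tend to zero almost everywhere (`fourierSeriesConvergesAE_of_hasSum`). -/

theorem sum_range_mul {E : Type*} [AddCommMonoid E] (f : ℕ → E) (a b : ℕ) :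
    ∑ i ∈ Finset.range (b * a), f i
      = ∑ e ∈ Finset.range b, ∑ i ∈ Finset.range a, f (i + e * a) := by
  induction b with
  | zero => simp
  | succ b ih =>
    rw [add_mul, one_mul, Finset.sum_range_add, ih, Finset.sum_range_succ]
    simp only [add_comm]

/-! ### Characters as functions of the index, and their sums -/

section Digits

variable {p : ℕ → ℕ}

theorem pow_succ (p : ℕ → ℕ) (k : ℕ) : vilenkinPow p (k + 1) = vilenkinPow p k * p k :=
  Finset.prod_range_succ _ _

theorem pow_zero (p : ℕ → ℕ) : vilenkinPow p 0 = 1 := rfl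

theorem pow_pos (hp : ∀ k, 2 ≤ p k) (k : ℕ) : 0 < vilenkinPow p k :=
  Finset.prod_pos fun j _ => by have := hp j; omega

theorem pow_pos_real (hp : ∀ k, 2 ≤ p k) (k : ℕ) : (0 : ℝ) < vilenkinPow p k :=
  Nat.cast_pos.2 (pow_pos hp k)

theorem lt_pow (hp : ∀ k, 2 ≤ p k) (k : ℕ) : k < vilenkinPow p k := by
  induction k with
  | zero => simp [pow_zero]
  | succ k ih =>
    rw [pow_succ]
    have := hp k
    nlinarith

theorem pow_dvd_pow (p : ℕ → ℕ) {m k : ℕ} (h : m ≤ k) : vilenkinPow p m ∣ vilenkinPow p k :=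
  Finset.prod_dvd_prod_of_subset _ _ _ (Finset.range_mono h)

theorem pow_le_pow (hp : ∀ k, 2 ≤ p k) {m k : ℕ} (h : m ≤ k) :
    vilenkinPow p m ≤ vilenkinPow p k :=
  Nat.le_of_dvd (pow_pos hp k) (pow_dvd_pow p h)

/-- The character with values `z k` on the generators, as a function of the index. -/
def digitChar (p : ℕ → ℕ) (z : ℕ → ℂ) (n : ℕ) : ℂ :=
  ∏ k ∈ Finset.range n, z k ^ (n / vilenkinPow p k % p k)

theorem digitChar_eq (hp : ∀ k, 2 ≤ p k) (z : ℕ → ℂ) {n L : ℕ} (h : n ≤ L) :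
    digitChar p z n = ∏ k ∈ Finset.range L, z k ^ (n / vilenkinPow p k % p k) := by
  refine Finset.prod_subset (Finset.range_mono h) fun k _ hk => ?_
  have h1 : n < vilenkinPow p k := by
    have := lt_pow hp k
    simp at hk
    omega
  simp [Nat.div_eq_of_lt h1]

/-- There are no carries: `i` uses only the digits below `m`, and a multiple of `vilenkinPow p m`
only those from `m` on. -/
theorem digitChar_add (hp : ∀ k, 2 ≤ p k) (z : ℕ → ℂ) {i m : ℕ} (hi : i < vilenkinPow p m)
    (b : ℕ) : digitChar p z (i + b * vilenkinPow p m)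
      = digitChar p z i * digitChar p z (b * vilenkinPow p m) := by
  rw [digitChar_eq hp z le_rfl, digitChar_eq hp z (Nat.le_add_right i (b * vilenkinPow p m)),
    digitChar_eq hp z (Nat.le_add_left (b * vilenkinPow p m) i), ← Finset.prod_mul_distrib]
  refine Finset.prod_congr rfl fun k _ => ?_
  rw [← pow_add]
  congr 1
  rcases lt_or_ge k m with hk | hk
  · obtain ⟨c, hc⟩ := pow_dvd_pow p (Nat.succ_le_of_lt hk)
    rw [Nat.succ_eq_add_one, pow_succ] at hc
    have e : b * vilenkinPow p m = vilenkinPow p k * (p k * (b * c)) := by rw [hc]; ring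
    rw [e, Nat.add_mul_div_left _ _ (pow_pos hp k), Nat.mul_div_cancel_left _ (pow_pos hp k)]
    simp
  · obtain ⟨c, hc⟩ := pow_dvd_pow p hk
    rw [hc, ← Nat.div_div_eq_div_mul, ← Nat.div_div_eq_div_mul, ← Nat.div_div_eq_div_mul,
      Nat.add_mul_div_right _ _ (pow_pos hp m), Nat.mul_div_cancel _ (pow_pos hp m),
      Nat.div_eq_of_lt hi]
    simp

theorem digitChar_mul_pow (hp : ∀ k, 2 ≤ p k) (z : ℕ → ℂ) {e k : ℕ} (he : e < p k) :
    digitChar p z (e * vilenkinPow p k) = z k ^ e := by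
  rw [digitChar_eq hp z (Nat.le_add_right _ (k + 1)), Finset.prod_eq_single k]
  · rw [Nat.mul_div_cancel _ (pow_pos hp k), Nat.mod_eq_of_lt he]
  · intro j _ hj
    rcases lt_or_gt_of_ne hj with hj | hj
    · obtain ⟨c, hc⟩ := pow_dvd_pow p (Nat.succ_le_of_lt hj)
      rw [Nat.succ_eq_add_one, pow_succ] at hc
      have e : e * vilenkinPow p k = vilenkinPow p j * (p j * (e * c)) := by rw [hc]; ring
      rw [e, Nat.mul_div_cancel_left _ (pow_pos hp j)]
      simp
    · have : e * vilenkinPow p k < vilenkinPow p j := by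
        calc e * vilenkinPow p k < vilenkinPow p (k + 1) := by
              rw [pow_succ, mul_comm]
              exact Nat.mul_lt_mul_of_pos_left he (pow_pos hp k)
          _ ≤ _ := pow_le_pow hp hj
      simp [Nat.div_eq_of_lt this]
  · intro h
    simp at h
    omega

theorem norm_digitChar {z : ℕ → ℂ} (hz : ∀ k, ‖z k‖ = 1) (n : ℕ) : ‖digitChar p z n‖ = 1 := by
  simp [digitChar, norm_prod, hz]

theorem digitChar_congr_block (hp : ∀ k, 2 ≤ p k) {z w : ℕ → ℂ} {s t b : ℕ}
    (h : ∀ k, s ≤ k → k < t → z k = w k) (hb : b * vilenkinPow p s < vilenkinPow p t) :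
    digitChar p z (b * vilenkinPow p s) = digitChar p w (b * vilenkinPow p s) := by
  refine Finset.prod_congr rfl fun k _ => ?_
  rcases lt_or_ge k s with hk | hk
  · obtain ⟨c, hc⟩ := pow_dvd_pow p (Nat.succ_le_of_lt hk)
    rw [Nat.succ_eq_add_one, pow_succ] at hc
    have e : b * vilenkinPow p s = vilenkinPow p k * (p k * (b * c)) := by rw [hc]; ring
    rw [e, Nat.mul_div_cancel_left _ (pow_pos hp k)]
    simp
  rcases lt_or_ge k t with hk' | hk'
  · rw [h k hk hk']
  · have := lt_of_lt_of_le hb (pow_le_pow hp hk')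
    simp [Nat.div_eq_of_lt this]

theorem digitChar_congr (hp : ∀ k, 2 ≤ p k) {z w : ℕ → ℂ} {t n : ℕ}
    (h : ∀ k, k < t → z k = w k) (hn : n < vilenkinPow p t) :
    digitChar p z n = digitChar p w n := by
  simpa [pow_zero] using digitChar_congr_block (b := n) (s := 0) hp (fun k _ hk => h k hk)
    (by simpa [pow_zero] using hn)

/-- The digit of the index at place `k` runs over a full period independently of the lower ones, so
a geometric sum of a nontrivial `p k`-th root of unity factors out. -/
theorem sum_digitChar_block_eq_zero (hp : ∀ k, 2 ≤ p k) {z : ℕ → ℂ} {s k : ℕ} (hs : s ≤ k)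
    (hz : z k ≠ 1) (hz' : z k ^ p k = 1) :
    ∑ i ∈ Finset.range (vilenkinPow p (k + 1) / vilenkinPow p s),
      digitChar p z (i * vilenkinPow p s) = 0 := by
  obtain ⟨c, hc⟩ := pow_dvd_pow p hs
  have hps := pow_pos hp s
  have e : vilenkinPow p (k + 1) / vilenkinPow p s = p k * c := by
    rw [pow_succ, hc, mul_assoc, Nat.mul_div_cancel_left _ hps, mul_comm]
  rw [e, sum_range_mul]
  have : ∀ e ∈ Finset.range (p k), ∑ i ∈ Finset.range c,
      digitChar p z ((i + e * c) * vilenkinPow p s)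
      = z k ^ e * ∑ i ∈ Finset.range c, digitChar p z (i * vilenkinPow p s) := by
    intro e he
    rw [Finset.mul_sum]
    refine Finset.sum_congr rfl fun i hi => ?_
    have e1 : (i + e * c) * vilenkinPow p s = i * vilenkinPow p s + e * vilenkinPow p k := by
      rw [hc]; ring
    have e2 : i * vilenkinPow p s < vilenkinPow p k := by
      rw [hc, mul_comm]
      exact Nat.mul_lt_mul_of_pos_left (Finset.mem_range.1 hi) hps
    rw [e1, digitChar_add hp z e2, digitChar_mul_pow hp z (Finset.mem_range.1 he), mul_comm]
  rw [Finset.sum_congr rfl this, ← Finset.sum_mul, geom_sum_eq hz, hz']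
  simp

theorem sum_digitChar_blocks_eq_zero (hp : ∀ k, 2 ≤ p k) {z : ℕ → ℂ} {s k : ℕ} (hs : s ≤ k)
    (hz : z k ≠ 1) (hz' : z k ^ p k = 1) (b : ℕ) :
    ∑ i ∈ Finset.range (b * (vilenkinPow p (k + 1) / vilenkinPow p s)),
      digitChar p z (i * vilenkinPow p s) = 0 := by
  have h0 := sum_digitChar_block_eq_zero hp hs hz hz'
  have hc := Nat.div_mul_cancel (pow_dvd_pow p (le_trans hs (Nat.le_succ k)))
  rw [Nat.succ_eq_add_one] at hc
  generalize vilenkinPow p (k + 1) / vilenkinPow p s = B at *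
  rw [sum_range_mul]
  refine Finset.sum_eq_zero fun e _ => ?_
  have : ∀ i ∈ Finset.range B, digitChar p z ((i + e * B) * vilenkinPow p s)
      = digitChar p z (i * vilenkinPow p s) * digitChar p z (e * vilenkinPow p (k + 1)) := by
    intro i hi
    have e1 : (i + e * B) * vilenkinPow p s
        = i * vilenkinPow p s + e * vilenkinPow p (k + 1) := by
      rw [← hc]; ring
    rw [e1, digitChar_add hp z]
    rw [← hc]
    exact Nat.mul_lt_mul_of_pos_right (Finset.mem_range.1 hi) (pow_pos hp s)
  rw [Finset.sum_congr rfl this, ← Finset.sum_mul, h0, zero_mul]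

/-- Complete periods cancel; only the remainder, shorter than one period, survives, and its terms
are unimodular. -/
theorem norm_sum_digitChar_le (hp : ∀ k, 2 ≤ p k) {z : ℕ → ℂ} (hz1 : ∀ k, ‖z k‖ = 1) {s k : ℕ}
    (hs : s ≤ k) (hz : z k ≠ 1) (hz' : z k ^ p k = 1) (q : ℕ) :
    ‖∑ i ∈ Finset.range q, digitChar p z (i * vilenkinPow p s)‖
      ≤ (vilenkinPow p (k + 1) : ℝ) / vilenkinPow p s := by
  have h0 := sum_digitChar_blocks_eq_zero hp hs hz hz'
    (q / (vilenkinPow p (k + 1) / vilenkinPow p s))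
  have hd := pow_dvd_pow p (le_trans hs (Nat.le_succ k))
  rw [Nat.succ_eq_add_one] at hd
  have hB : 0 < vilenkinPow p (k + 1) / vilenkinPow p s :=
    Nat.div_pos (Nat.le_of_dvd (pow_pos hp _) hd) (pow_pos hp s)
  rw [← Nat.cast_div hd (pow_pos_real hp s).ne']
  generalize vilenkinPow p (k + 1) / vilenkinPow p s = B at *
  conv_lhs => rw [← Nat.div_add_mod q B, mul_comm, Finset.sum_range_add, h0, zero_add]
  refine (norm_sum_le _ _).trans ?_
  simp only [norm_digitChar hz1, Finset.sum_const, Finset.card_range, nsmul_eq_mul, mul_one]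
  exact_mod_cast (Nat.mod_lt _ hB).le

end Digits

/-! ### Generators at points, and Dirichlet kernels -/

section Points

variable {p : ℕ → ℕ}

theorem digit_lt (hp : ∀ k, 2 ≤ p k) (k : ℕ) (x : unitInterval) : vilenkinDigit p k x < p k :=
  Nat.mod_lt _ (by have := hp k; omega)

theorem norm_vilenkinRademacher (k : ℕ) (x : unitInterval) : ‖vilenkinRademacher p k x‖ = 1 := by
  rw [vilenkinRademacher, Complex.norm_exp]
  have : 2 * (Real.pi : ℂ) * Complex.I * (vilenkinDigit p k x : ℂ) / (p k : ℂ)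
    = ((2 * Real.pi * (vilenkinDigit p k x : ℝ) / (p k : ℝ) : ℝ) : ℂ) * Complex.I := by
    push_cast; ring
  rw [this, Complex.re_ofReal_mul]
  simp

theorem vilenkinRademacher_eq_pow (k : ℕ) (x : unitInterval) :
    vilenkinRademacher p k x
      = Complex.exp (2 * Real.pi * Complex.I / (p k : ℂ)) ^ vilenkinDigit p k x := by
  rw [← Complex.exp_nat_mul, vilenkinRademacher]
  congr 1
  ring

theorem vilenkinRademacher_inj (hp : ∀ k, 2 ≤ p k) {k : ℕ} {x y : unitInterval} :
    vilenkinRademacher p k x = vilenkinRademacher p k y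
      ↔ vilenkinDigit p k x = vilenkinDigit p k y := by
  have h := Complex.isPrimitiveRoot_exp (p k) (by have := hp k; omega)
  rw [vilenkinRademacher_eq_pow, vilenkinRademacher_eq_pow]
  exact ⟨fun e => h.pow_inj (digit_lt hp k x) (digit_lt hp k y) e, fun e => by rw [e]⟩

theorem vilenkinRademacher_pow (hp : ∀ k, 2 ≤ p k) (k : ℕ) (x : unitInterval) :
    vilenkinRademacher p k x ^ p k = 1 := by
  have h := Complex.isPrimitiveRoot_exp (p k) (by have := hp k; omega)
  rw [vilenkinRademacher_eq_pow, pow_right_comm, h.pow_eq_one, one_pow]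

/-- The values of the generators at the difference of two points. -/
noncomputable def diffGen (p : ℕ → ℕ) (x y : unitInterval) (k : ℕ) : ℂ :=
  vilenkinRademacher p k x * (starRingEnd ℂ) (vilenkinRademacher p k y)

theorem norm_diffGen (x y : unitInterval) (k : ℕ) : ‖diffGen p x y k‖ = 1 := by
  simp [diffGen, norm_vilenkinRademacher]

theorem diffGen_pow (hp : ∀ k, 2 ≤ p k) (x y : unitInterval) (k : ℕ) :
    diffGen p x y k ^ p k = 1 := by
  rw [diffGen, mul_pow, ← map_pow, vilenkinRademacher_pow hp, vilenkinRademacher_pow hp]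
  simp

theorem diffGen_eq_one (hp : ∀ k, 2 ≤ p k) {x y : unitInterval} {k : ℕ} :
    diffGen p x y k = 1 ↔ vilenkinDigit p k x = vilenkinDigit p k y := by
  rw [← vilenkinRademacher_inj hp, diffGen]
  have h : vilenkinRademacher p k y * (starRingEnd ℂ) (vilenkinRademacher p k y) = 1 := by
    rw [Complex.mul_conj, Complex.normSq_eq_norm_sq, norm_vilenkinRademacher]; simp
  have h0 : (starRingEnd ℂ) (vilenkinRademacher p k y) ≠ 0 := right_ne_zero_of_mul_eq_one h
  constructor
  · intro e
    exact mul_right_cancel₀ h0 (e.trans h.symm)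
  · intro e
    rw [e, h]

/-- Each kernel thus becomes a character sum at the digitwise difference of the two points. -/
theorem vilenkin_mul_conj (n : ℕ) (x y : unitInterval) :
    vilenkin p n x * (starRingEnd ℂ) (vilenkin p n y) = digitChar p (diffGen p x y) n := by
  simp only [vilenkin, digitChar, map_prod, map_pow, ← Finset.prod_mul_distrib, diffGen, mul_pow]

theorem norm_vilenkin (n : ℕ) (x : unitInterval) : ‖vilenkin p n x‖ = 1 :=
  norm_digitChar (fun k => norm_vilenkinRademacher k x) n

theorem vilenkin_add (hp : ∀ k, 2 ≤ p k) {i m : ℕ} (hi : i < vilenkinPow p m) (b : ℕ)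
    (x : unitInterval) : vilenkin p (i + b * vilenkinPow p m) x
      = vilenkin p i x * vilenkin p (b * vilenkinPow p m) x :=
  digitChar_add hp _ hi b

/-- The points whose digits at the places in `[s, t)` are those of `d`. -/
def block (p : ℕ → ℕ) (s t : ℕ) (d : ℕ → ℕ) : Set unitInterval :=
  {x | ∀ k, s ≤ k → k < t → vilenkinDigit p k x = d k}

theorem vilenkin_congr (hp : ∀ k, 2 ≤ p k) {x y : unitInterval} {t n : ℕ}
    (h : ∀ k, k < t → vilenkinDigit p k x = vilenkinDigit p k y) (hn : n < vilenkinPow p t) :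
    vilenkin p n x = vilenkin p n y :=
  digitChar_congr hp (fun k hk => (vilenkinRademacher_inj hp).2 (h k hk)) hn

theorem vilenkin_congr_block (hp : ∀ k, 2 ≤ p k) {x y : unitInterval} {s t b : ℕ}
    (h : ∀ k, s ≤ k → k < t → vilenkinDigit p k x = vilenkinDigit p k y)
    (hb : b * vilenkinPow p s < vilenkinPow p t) :
    vilenkin p (b * vilenkinPow p s) x = vilenkin p (b * vilenkinPow p s) y :=
  digitChar_congr_block hp (fun k hk hk' => (vilenkinRademacher_inj hp).2 (h k hk hk')) hb

/-- The kernel of the partial sums along the multiples of `vilenkinPow p s`. -/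
noncomputable def kernel (p : ℕ → ℕ) (s q : ℕ) (x y : unitInterval) : ℂ :=
  ∑ i ∈ Finset.range q, vilenkin p (i * vilenkinPow p s) x
    * (starRingEnd ℂ) (vilenkin p (i * vilenkinPow p s) y)

theorem norm_kernel_le (hp : ∀ k, 2 ≤ p k) {x y : unitInterval} {s k : ℕ} (hs : s ≤ k)
    (h : vilenkinDigit p k x ≠ vilenkinDigit p k y) (q : ℕ) :
    ‖kernel p s q x y‖ ≤ (vilenkinPow p (k + 1) : ℝ) / vilenkinPow p s := by
  simp only [kernel, vilenkin_mul_conj]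
  exact norm_sum_digitChar_le hp (norm_diffGen x y) hs (mt (diffGen_eq_one hp).1 h)
    (diffGen_pow hp x y k) q

/-- If some digit below `m` differs, the range is a whole number of periods for that digit and the
sum cancels; otherwise every term is `1`. -/
theorem kernel_zero_pow (hp : ∀ k, 2 ≤ p k) (m : ℕ) (x y : unitInterval) :
    kernel p 0 (vilenkinPow p m) x y
      = (block p 0 m (fun k => vilenkinDigit p k x)).indicator
          (fun _ => (vilenkinPow p m : ℂ)) y := by
  by_cases h : ∀ k, k < m → vilenkinDigit p k y = vilenkinDigit p k x
  · rw [Set.indicator_of_mem (show y ∈ block p 0 m _ from fun k _ hk => h k hk), kernel]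
    have : ∀ i ∈ Finset.range (vilenkinPow p m), vilenkin p (i * vilenkinPow p 0) x
        * (starRingEnd ℂ) (vilenkin p (i * vilenkinPow p 0) y) = 1 := by
      intro i hi
      rw [pow_zero, mul_one, ← vilenkin_congr hp h (Finset.mem_range.1 hi), Complex.mul_conj,
        Complex.normSq_eq_norm_sq, norm_vilenkin]
      simp
    rw [Finset.sum_congr rfl this]
    simp
  · rw [Set.indicator_of_notMem (fun hy : ∀ k, 0 ≤ k → k < m → _ =>
      h fun k hk => hy k (Nat.zero_le k) hk)]
    push Not at h
    obtain ⟨k, hk, hne⟩ := h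
    obtain ⟨c, hc⟩ := pow_dvd_pow p (Nat.succ_le_of_lt hk)
    have := sum_digitChar_blocks_eq_zero hp (Nat.zero_le k)
      (mt (diffGen_eq_one hp (x := x) (y := y)).1 hne.symm) (diffGen_pow hp x y k) c
    simp only [kernel, vilenkin_mul_conj]
    rw [hc, mul_comm]
    simpa [pow_zero] using this

theorem walsh_eq_vilenkin : walsh = vilenkin (fun _ => 2) := by
  have hP : ∀ k, vilenkinPow (fun _ => 2) k = 2 ^ k := fun k => by simp [vilenkinPow]
  have hr : ∀ k x, ((rademacher k x : ℝ) : ℂ) = vilenkinRademacher (fun _ => 2) k x := by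
    intro k x
    rw [vilenkinRademacher_eq_pow]
    have : Complex.exp (2 * Real.pi * Complex.I / ((2 : ℕ) : ℂ)) = -1 := by
      rw [← Complex.exp_pi_mul_I]
      congr 1
      push_cast
      ring
    rw [this, vilenkinDigit, hP, rademacher]
    push_cast
    rw [neg_one_pow_eq_pow_mod_two]
  funext n x
  simp only [walsh, vilenkin, hP]
  push_cast
  simp only [hr]

end Points

/-! ### Intervals of a given level, their measure, and functions of finite level -/

variable {p : ℕ → ℕ}

/-- The index of the interval of length `1 / vilenkinPow p m` containing a point. -/
noncomputable def cylIndex (p : ℕ → ℕ) (m : ℕ) (x : unitInterval) : ℕ :=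
  ⌊(vilenkinPow p m : ℝ) * (x : ℝ)⌋₊

theorem cylIndex_succ (hp : ∀ k, 2 ≤ p k) (m : ℕ) (x : unitInterval) :
    cylIndex p (m + 1) x = cylIndex p m x * p m + vilenkinDigit p m x := by
  have h0 : (p m : ℝ) ≠ 0 := by have := hp m; positivity
  have h : cylIndex p (m + 1) x / p m = cylIndex p m x := by
    rw [cylIndex, cylIndex, ← Nat.floor_div_natCast, pow_succ]
    congr 1
    push_cast
    field_simp
  rw [← h, vilenkinDigit, ← cylIndex, mul_comm, Nat.div_add_mod]

theorem cylIndex_lt (hp : ∀ k, 2 ≤ p k) (m : ℕ) {x : unitInterval} (hx : (x : ℝ) < 1) :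
    cylIndex p m x < vilenkinPow p m := by
  have := pow_pos_real hp m
  rw [cylIndex, Nat.floor_lt (mul_nonneg this.le x.2.1)]
  nlinarith

/-- The index of the interval whose points have the digits `d`. -/
def code (p d : ℕ → ℕ) : ℕ → ℕ
  | 0 => 0
  | m + 1 => code p d m * p m + d m

theorem code_lt {d : ℕ → ℕ} (hd : ∀ k, d k < p k) (m : ℕ) :
    code p d m < vilenkinPow p m := by
  induction m with
  | zero => simp [code, pow_zero]
  | succ m ih =>
    have := hd m
    rw [code, pow_succ]
    nlinarith

theorem cylIndex_eq_code_iff (hp : ∀ k, 2 ≤ p k) {d : ℕ → ℕ} (hd : ∀ k, d k < p k) (m : ℕ)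
    {x : unitInterval} (hx : (x : ℝ) < 1) :
    cylIndex p m x = code p d m ↔ ∀ k, k < m → vilenkinDigit p k x = d k := by
  induction m with
  | zero => simp [code, cylIndex, pow_zero, hx]
  | succ m ih =>
    rw [cylIndex_succ hp, code]
    have h1 := digit_lt hp m x
    have h2 := hd m
    constructor
    · intro h
      have e1 : vilenkinDigit p m x = d m := by
        have := congrArg (· % p m) h
        simpa [Nat.add_mod, Nat.mod_eq_of_lt h1, Nat.mod_eq_of_lt h2]
          using this
      have e2 : cylIndex p m x = code p d m := by
        rw [e1] at h
        exact Nat.eq_of_mul_eq_mul_right (by omega) (Nat.add_right_cancel h)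
      intro k hk
      rcases Nat.lt_succ_iff_lt_or_eq.1 hk with hk | rfl
      · exact ih.1 e2 k hk
      · exact e1
    · intro h
      rw [ih.2 fun k hk => h k (hk.trans (Nat.lt_succ_self m)), h m (Nat.lt_succ_self m)]

theorem cylIndex_eq_iff (hp : ∀ k, 2 ≤ p k) (m : ℕ) {x y : unitInterval} (hx : (x : ℝ) < 1)
    (hy : (y : ℝ) < 1) :
    cylIndex p m x = cylIndex p m y ↔ ∀ k, k < m → vilenkinDigit p k x = vilenkinDigit p k y := by
  have hd := fun k => digit_lt hp k y
  rw [(cylIndex_eq_code_iff hp hd m hy).2 fun _ _ => rfl, cylIndex_eq_code_iff hp hd m hx]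

theorem exists_cylIndex_eq (hp : ∀ k, 2 ≤ p k) {m j : ℕ} (hj : j < vilenkinPow p m) :
    ∃ x : unitInterval, (x : ℝ) < 1 ∧ cylIndex p m x = j := by
  have h := pow_pos_real hp m
  have hj' : (j : ℝ) < vilenkinPow p m := by exact_mod_cast hj
  have h1 : (j : ℝ) / vilenkinPow p m < 1 := by rwa [div_lt_one h]
  refine ⟨⟨j / vilenkinPow p m, by positivity, h1.le⟩, h1, ?_⟩
  simp only [cylIndex]
  rw [mul_div_cancel₀ _ h.ne', Nat.floor_natCast]

theorem exists_digits_eq (hp : ∀ k, 2 ≤ p k) {d : ℕ → ℕ} (hd : ∀ k, d k < p k) (m : ℕ) :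
    ∃ x : unitInterval, (x : ℝ) < 1 ∧ ∀ k, k < m → vilenkinDigit p k x = d k := by
  obtain ⟨x, hx, h⟩ := exists_cylIndex_eq hp (code_lt hd m)
  exact ⟨x, hx, (cylIndex_eq_code_iff hp hd m hx).1 h⟩

theorem measurable_cylIndex (m : ℕ) : Measurable (cylIndex p m) :=
  Nat.measurable_floor.comp (measurable_subtype_coe.const_mul _)

theorem measurable_digit (k : ℕ) : Measurable (vilenkinDigit p k) :=
  (measurable_of_countable (fun n : ℕ => n % p k)).comp (measurable_cylIndex (k + 1))

theorem measurableSet_block (s t : ℕ) (d : ℕ → ℕ) : MeasurableSet (block p s t d) := by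
  simp only [block, Set.ofPred_forall]
  exact MeasurableSet.iInter fun k => MeasurableSet.iInter fun _ => MeasurableSet.iInter fun _ =>
    measurable_digit k (measurableSet_singleton (d k))

theorem measurable_vilenkin (n : ℕ) : Measurable (vilenkin p n) := by
  unfold vilenkin
  refine Finset.measurable_prod _ fun k _ => ?_
  exact ((measurable_of_countable (fun j : ℕ =>
    Complex.exp (2 * Real.pi * Complex.I * (j : ℂ) / (p k : ℂ)))).comp
      (measurable_digit k)).pow_const _

/-- The endpoint `1` must be set aside: all its digits are `0`, as for the point `0`, but its
`cylIndex` is `vilenkinPow p m`, out of range. -/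
theorem ae_lt_one : ∀ᵐ x : unitInterval, (x : ℝ) < 1 := by
  have : ∀ᵐ x : unitInterval, x ≠ 1 := by
    simp [ae_iff]
  filter_upwards [this] with x hx
  exact lt_of_le_of_ne x.2.2 fun h => hx (Subtype.ext h)

theorem volume_cylIndex_eq (hp : ∀ k, 2 ≤ p k) {m j : ℕ} (hj : j < vilenkinPow p m) :
    volume.real {x : unitInterval | cylIndex p m x = j} = 1 / vilenkinPow p m := by
  have h := pow_pos_real hp m
  have hj' : (j : ℝ) + 1 ≤ vilenkinPow p m := by exact_mod_cast hj
  have e : {x : unitInterval | cylIndex p m x = j} = (fun x : unitInterval => (x : ℝ)) ⁻¹'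
      Set.Ico ((j : ℝ) / vilenkinPow p m) (((j : ℝ) + 1) / vilenkinPow p m) := by
    ext x
    simp only [cylIndex, Set.mem_ofPred_eq, Set.mem_preimage, Set.mem_Ico]
    rw [Nat.floor_eq_iff (mul_nonneg h.le x.2.1), div_le_iff₀ h, lt_div_iff₀ h, mul_comm]
  rw [e, Measure.real, unitInterval.measurePreserving_coe.measure_preimage
    measurableSet_Ico.nullMeasurableSet, Measure.restrict_apply measurableSet_Ico,
    Set.inter_eq_left.2, Real.volume_Ico, ENNReal.toReal_ofReal]
  · ring
  · rw [sub_nonneg]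
    gcongr
    linarith
  · intro x hx
    refine ⟨le_trans (by positivity) hx.1, hx.2.le.trans ?_⟩
    rwa [div_le_one h]

theorem cylIndex_ae_eq_block (hp : ∀ k, 2 ≤ p k) {d : ℕ → ℕ} (hd : ∀ k, d k < p k) (m : ℕ) :
    ({x : unitInterval | cylIndex p m x = code p d m} : Set unitInterval)
      =ᵐ[volume] block p 0 m d := by
  filter_upwards [ae_lt_one] with x hx
  apply propext
  exact (cylIndex_eq_code_iff hp hd m hx).trans ⟨fun h k _ => h k, fun h k => h k (Nat.zero_le k)⟩

theorem volume_block_zero (hp : ∀ k, 2 ≤ p k) {d : ℕ → ℕ} (hd : ∀ k, d k < p k) (m : ℕ) :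
    volume.real (block p 0 m d) = 1 / vilenkinPow p m := by
  rw [← volume_cylIndex_eq hp (code_lt hd m)]
  exact measureReal_congr (cylIndex_ae_eq_block hp hd m).symm

theorem volume_block_inter (hp : ∀ k, 2 ≤ p k) {d e : ℕ → ℕ} (hd : ∀ k, d k < p k)
    (he : ∀ k, e k < p k) {s t : ℕ} (hst : s ≤ t) :
    volume.real (block p 0 s d ∩ block p s t e) = 1 / vilenkinPow p t := by
  have h : block p 0 s d ∩ block p s t e = block p 0 t (fun k => if k < s then d k else e k) := by
    ext x
    simp only [block, Set.mem_inter_iff, Set.mem_ofPred_eq, Nat.zero_le, true_imp_iff]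
    constructor
    · rintro ⟨h1, h2⟩ k hk
      split_ifs with h
      · exact h1 k h
      · exact h2 k (not_lt.1 h) hk
    · intro h
      refine ⟨fun k hk => ?_, fun k hk hk' => ?_⟩
      · simpa [hk] using h k (hk.trans_le hst)
      · simpa [not_lt.2 hk] using h k hk'
  rw [h, volume_block_zero hp]
  intro k
  split_ifs
  · exact hd k
  · exact he k

theorem integral_eq_sum_cylIndex {E : Type*} [NormedAddCommGroup E] [NormedSpace ℝ E]
    (hp : ∀ k, 2 ≤ p k) (s : ℕ) {h : unitInterval → E}
    (hh : Integrable h) :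
    ∫ x, h x = ∑ j ∈ Finset.range (vilenkinPow p s), ∫ x in {x | cylIndex p s x = j}, h x := by
  rw [← integral_biUnion_finset, ← setIntegral_univ]
  · refine setIntegral_congr_set ?_
    filter_upwards [ae_lt_one] with x hx
    apply propext
    refine ⟨fun _ => ?_, fun _ => trivial⟩
    exact Set.mem_biUnion (x := cylIndex p s x)
      (Finset.mem_coe.2 (Finset.mem_range.2 (cylIndex_lt hp s hx)))
      (rfl : cylIndex p s x = cylIndex p s x)
  · exact fun j _ => measurable_cylIndex s (measurableSet_singleton j)
  · intro i _ j _ hij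
    rw [Function.onFun, Set.disjoint_left]
    intro x hx hx'
    exact hij (hx.symm.trans hx')
  · exact fun j _ => hh.integrableOn

/-- The function depends only on the first `s` digits. -/
def IsLevel (p : ℕ → ℕ) (s : ℕ) (F : unitInterval → ℂ) : Prop :=
  ∀ x y, (∀ k, k < s → vilenkinDigit p k x = vilenkinDigit p k y) → F x = F y

theorem IsLevel.mono {s t : ℕ} {F : unitInterval → ℂ} (h : IsLevel p s F) (hst : s ≤ t) :
    IsLevel p t F := fun x y hxy => h x y fun k hk => hxy k (hk.trans_le hst)

theorem IsLevel.mul {s : ℕ} {F H : unitInterval → ℂ} (hF : IsLevel p s F) (hH : IsLevel p s H) :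
    IsLevel p s (fun x => F x * H x) := fun x y hxy => by simp only [hF x y hxy, hH x y hxy]

theorem IsLevel.conj {s : ℕ} {F : unitInterval → ℂ} (hF : IsLevel p s F) :
    IsLevel p s (fun x => (starRingEnd ℂ) (F x)) := fun x y hxy => by simp only [hF x y hxy]

theorem isLevel_vilenkin (hp : ∀ k, 2 ≤ p k) {s n : ℕ} (hn : n < vilenkinPow p s) :
    IsLevel p s (vilenkin p n) := fun _ _ hxy => vilenkin_congr hp hxy hn

theorem isLevel_indicator_block (s t : ℕ) (d : ℕ → ℕ) (a : ℂ) :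
    IsLevel p t ((block p s t d).indicator fun _ => a) := by
  intro x y hxy
  have : x ∈ block p s t d ↔ y ∈ block p s t d :=
    forall_congr' fun k => forall_congr' fun _ => forall_congr' fun hk => by rw [hxy k hk]
  by_cases h : x ∈ block p s t d
  · rw [Set.indicator_of_mem h, Set.indicator_of_mem (this.1 h)]
  · rw [Set.indicator_of_notMem h, Set.indicator_of_notMem (mt this.2 h)]

theorem IsLevel.exists_factor (hp : ∀ k, 2 ≤ p k) {s : ℕ} {F : unitInterval → ℂ}
    (hF : IsLevel p s F) :
    ∃ φ : ℕ → ℂ, ∀ x : unitInterval, (x : ℝ) < 1 → F x = φ (cylIndex p s x) := by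
  choose! y hy1 hy using fun j => exists_cylIndex_eq (m := s) (j := j) hp
  refine ⟨fun j => F (y j), fun x hx => hF _ _ ?_⟩
  have hlt := cylIndex_lt hp s hx
  exact (cylIndex_eq_iff hp s hx (hy1 _ hlt)).1 (hy _ hlt).symm

theorem IsLevel.exists_bound (hp : ∀ k, 2 ≤ p k) {s : ℕ} {F : unitInterval → ℂ}
    (hF : IsLevel p s F) : ∃ C : ℝ, ∀ᵐ x, ‖F x‖ ≤ C := by
  obtain ⟨φ, hφ⟩ := hF.exists_factor hp
  refine ⟨∑ j ∈ Finset.range (vilenkinPow p s), ‖φ j‖, ?_⟩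
  filter_upwards [ae_lt_one] with x hx
  rw [hφ x hx]
  exact Finset.single_le_sum (f := fun j => ‖φ j‖) (fun j _ => norm_nonneg _)
    (Finset.mem_range.2 (cylIndex_lt hp s hx))

theorem IsLevel.aestronglyMeasurable (hp : ∀ k, 2 ≤ p k) {s : ℕ} {F : unitInterval → ℂ}
    (hF : IsLevel p s F) : AEStronglyMeasurable F := by
  obtain ⟨φ, hφ⟩ := hF.exists_factor hp
  have hm : Measurable fun x => φ (cylIndex p s x) :=
    (measurable_of_countable φ).comp (measurable_cylIndex s)
  refine hm.aestronglyMeasurable.congr ?_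
  filter_upwards [ae_lt_one] with x hx
  exact (hφ x hx).symm

theorem IsLevel.integrable (hp : ∀ k, 2 ≤ p k) {s : ℕ} {F : unitInterval → ℂ}
    (hF : IsLevel p s F) : Integrable F := by
  obtain ⟨C, hC⟩ := hF.exists_bound hp
  exact Integrable.of_bound (hF.aestronglyMeasurable hp) C hC

theorem IsLevel.integrable_mul (hp : ∀ k, 2 ≤ p k) {s : ℕ} {F w : unitInterval → ℂ}
    (hF : IsLevel p s F) (hw : Integrable w) : Integrable fun x => F x * w x := by
  obtain ⟨C, hC⟩ := hF.exists_bound hp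
  exact hw.bdd_mul (hF.aestronglyMeasurable hp) hC

/-- A function with the same integral over all intervals of level `s` is uncorrelated with the
functions of level `s`. -/
theorem IsLevel.integral_mul (hp : ∀ k, 2 ≤ p k) {s : ℕ} {F w : unitInterval → ℂ}
    (hF : IsLevel p s F) (hw : Integrable w) {κ : ℂ}
    (h : ∀ d : ℕ → ℕ, (∀ k, d k < p k) → ∫ x in block p 0 s d, w x = κ) :
    ∫ x, F x * w x = κ * vilenkinPow p s * ∫ x, F x := by
  obtain ⟨φ, hφ⟩ := hF.exists_factor hp
  have hms : ∀ j, MeasurableSet {x : unitInterval | cylIndex p s x = j} :=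
    fun j => measurable_cylIndex s (measurableSet_singleton j)
  have key : ∀ (u : unitInterval → ℂ) (j : ℕ),
      ∫ x in {x | cylIndex p s x = j}, F x * u x = φ j * ∫ x in {x | cylIndex p s x = j}, u x := by
    intro u j
    rw [← integral_const_mul]
    refine setIntegral_congr_ae (hms j) ?_
    filter_upwards [ae_lt_one] with x hx hj
    rw [hφ x hx, show cylIndex p s x = j from hj]
  have h1 : ∀ j < vilenkinPow p s, ∫ x in {x | cylIndex p s x = j}, w x = κ := by
    intro j hj
    obtain ⟨y, hy, rfl⟩ := exists_cylIndex_eq hp hj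
    have hd := fun k => digit_lt hp k y
    rw [(cylIndex_eq_code_iff hp hd s hy).2 fun _ _ => rfl, ← h _ hd]
    exact setIntegral_congr_set (cylIndex_ae_eq_block hp hd s)
  have h2 : ∫ x, F x = ∑ j ∈ Finset.range (vilenkinPow p s), φ j * (1 / vilenkinPow p s) := by
    rw [integral_eq_sum_cylIndex hp s (hF.integrable hp)]
    refine Finset.sum_congr rfl fun j hj => ?_
    have := key (fun _ => 1) j
    simp only [mul_one] at this
    rw [this, setIntegral_const, volume_cylIndex_eq hp (Finset.mem_range.1 hj)]
    simp
  have h3 := (pow_pos_real hp s).ne'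
  have h3' : (vilenkinPow p s : ℂ) ≠ 0 := by exact_mod_cast h3
  rw [integral_eq_sum_cylIndex hp s (hF.integrable_mul hp hw), h2, Finset.mul_sum]
  refine Finset.sum_congr rfl fun j hj => ?_
  rw [key, h1 j (Finset.mem_range.1 hj)]
  field_simp

/-! ### Fourier coefficients and partial sums; the effect of the comb -/

theorem integrable_mul_conj_vilenkin {g : unitInterval → ℂ} (hg : Integrable g) (n : ℕ) :
    Integrable fun t => g t * (starRingEnd ℂ) (vilenkin p n t) :=
  hg.mul_bdd (c := 1)
    ((Complex.continuous_conj.measurable.comp (measurable_vilenkin n)).aestronglyMeasurable)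
    (Eventually.of_forall fun x => by simp [norm_vilenkin])

theorem systemCoeff_sub {g h : unitInterval → ℂ} (hg : Integrable g) (hh : Integrable h) (n : ℕ) :
    systemCoeff (vilenkin p) (fun x => g x - h x) n
      = systemCoeff (vilenkin p) g n - systemCoeff (vilenkin p) h n := by
  simp only [systemCoeff, sub_mul]
  exact integral_sub (integrable_mul_conj_vilenkin hg n) (integrable_mul_conj_vilenkin hh n)

theorem systemPartialSum_sub {g h : unitInterval → ℂ} (hg : Integrable g) (hh : Integrable h)
    (N : ℕ) (x : unitInterval) :
    systemPartialSum (vilenkin p) (fun x => g x - h x) N x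
      = systemPartialSum (vilenkin p) g N x - systemPartialSum (vilenkin p) h N x := by
  simp only [systemPartialSum, systemCoeff_sub hg hh, sub_mul, Finset.sum_sub_distrib]

theorem systemPartialSum_eq_integral {g : unitInterval → ℂ} (hg : Integrable g) (N : ℕ)
    (x : unitInterval) :
    systemPartialSum (vilenkin p) g N x = ∫ t, g t * kernel p 0 N x t := by
  simp only [systemPartialSum, systemCoeff, kernel, pow_zero, mul_one, Finset.mul_sum]
  rw [integral_finsetSum]
  · refine Finset.sum_congr rfl fun n _ => ?_
    rw [← integral_mul_const]
    congr 1
    ext t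
    ring
  · intro n _
    refine ((integrable_mul_conj_vilenkin (p := p) hg n).mul_const (vilenkin p n x)).congr ?_
    exact Eventually.of_forall fun t => by ring

theorem IsLevel.systemPartialSum_pow (hp : ∀ k, 2 ≤ p k) {m : ℕ} {h : unitInterval → ℂ}
    (hh : IsLevel p m h) (x : unitInterval) :
    systemPartialSum (vilenkin p) h (vilenkinPow p m) x = h x := by
  rw [systemPartialSum_eq_integral (hh.integrable hp)]
  have : ∀ t, h t * kernel p 0 (vilenkinPow p m) x t
      = (block p 0 m (fun k => vilenkinDigit p k x)).indicator
          (fun _ => h x * (vilenkinPow p m : ℂ)) t := by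
    intro t
    rw [kernel_zero_pow hp]
    by_cases ht : t ∈ block p 0 m (fun k => vilenkinDigit p k x)
    · rw [Set.indicator_of_mem ht, Set.indicator_of_mem ht,
        hh t x fun k hk => ht k (Nat.zero_le k) hk]
    · rw [Set.indicator_of_notMem ht, Set.indicator_of_notMem ht, mul_zero]
  simp only [this]
  rw [integral_indicator_const _ (measurableSet_block _ _ _),
    volume_block_zero hp fun k => digit_lt hp k x]
  have h3 : (vilenkinPow p m : ℂ) ≠ 0 := by exact_mod_cast (pow_pos_real hp m).ne'
  rw [Complex.real_smul]
  push_cast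
  field_simp

/-- Parseval's identity, from the reproduction of `h` by its own partial sum. -/
theorem IsLevel.sum_coeff_mul_conj (hp : ∀ k, 2 ≤ p k) {m : ℕ} {h : unitInterval → ℂ}
    (hh : IsLevel p m h) :
    ∑ n ∈ Finset.range (vilenkinPow p m), systemCoeff (vilenkin p) h n
      * (starRingEnd ℂ) (systemCoeff (vilenkin p) h n) = ∫ x, h x * (starRingEnd ℂ) (h x) := by
  have : ∀ x, h x * (starRingEnd ℂ) (h x) = ∑ n ∈ Finset.range (vilenkinPow p m),
      (starRingEnd ℂ) (systemCoeff (vilenkin p) h n)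
        * (h x * (starRingEnd ℂ) (vilenkin p n x)) := by
    intro x
    have h1 := congrArg (starRingEnd ℂ) (hh.systemPartialSum_pow hp x)
    rw [← h1, systemPartialSum, map_sum, Finset.mul_sum]
    refine Finset.sum_congr rfl fun n _ => ?_
    rw [map_mul]
    ring
  simp only [this]
  rw [integral_finsetSum]
  · refine Finset.sum_congr rfl fun n _ => ?_
    rw [integral_const_mul, mul_comm, systemCoeff]
  · exact fun n _ => (integrable_mul_conj_vilenkin (hh.integrable hp) n).const_mul _

/-- A function of level `m` is also of level `n + 1`. Parseval at both levels gives the same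
integral, so the squares of the coefficients in between sum to zero. -/
theorem IsLevel.systemCoeff_eq_zero (hp : ∀ k, 2 ≤ p k) {m n : ℕ} {h : unitInterval → ℂ}
    (hh : IsLevel p m h) (hn : vilenkinPow p m ≤ n) : systemCoeff (vilenkin p) h n = 0 := by
  have hmn : m ≤ n + 1 := ((lt_pow hp m).le.trans hn).trans (Nat.le_succ n)
  have h1 := (hh.sum_coeff_mul_conj hp).trans ((hh.mono hmn).sum_coeff_mul_conj hp).symm
  rw [← Finset.sum_range_add_sum_Ico _ (pow_le_pow hp hmn), left_eq_add] at h1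
  simp only [Complex.mul_conj, ← Complex.ofReal_sum] at h1
  rw [Complex.ofReal_eq_zero, Finset.sum_eq_zero_iff_of_nonneg fun _ _ => Complex.normSq_nonneg _]
    at h1
  have := lt_pow hp (n + 1)
  exact Complex.normSq_eq_zero.1 (h1 n (Finset.mem_Ico.2 ⟨hn, by omega⟩))

theorem IsLevel.systemPartialSum_eq (hp : ∀ k, 2 ≤ p k) {m N : ℕ} {h : unitInterval → ℂ}
    (hh : IsLevel p m h) (hN : vilenkinPow p m ≤ N) (x : unitInterval) :
    systemPartialSum (vilenkin p) h N x = h x := by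
  conv_rhs => rw [← hh.systemPartialSum_pow hp x]
  rw [systemPartialSum, systemPartialSum, ← Finset.sum_range_add_sum_Ico _ hN, add_eq_left]
  refine Finset.sum_eq_zero fun n hn => ?_
  rw [hh.systemCoeff_eq_zero hp (Finset.mem_Ico.1 hn).1, zero_mul]

/-- The normalized indicator function of the points having the digits `e` at the places
in `[s, t)`. -/
noncomputable def comb (p : ℕ → ℕ) (s t : ℕ) (e : ℕ → ℕ) : unitInterval → ℂ :=
  (block p s t e).indicator fun _ => (vilenkinPow p t : ℂ) / vilenkinPow p s

theorem isLevel_comb (s t : ℕ) (e : ℕ → ℕ) : IsLevel p t (comb p s t e) :=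
  isLevel_indicator_block s t e _

/-- The character of index `b * vilenkinPow p s` sees only digits in `[s, t)`, all fixed on the
support of the comb. The integral is therefore independent of `d`, which is what
`IsLevel.integral_mul` requires. -/
theorem setIntegral_comb_mul_conj (hp : ∀ k, 2 ≤ p k) {d e : ℕ → ℕ} (hd : ∀ k, d k < p k)
    (he : ∀ k, e k < p k) {s t b : ℕ} (hst : s ≤ t) (hb : b * vilenkinPow p s < vilenkinPow p t)
    {y : unitInterval} (hy : y ∈ block p s t e) :
    ∫ x in block p 0 s d, comb p s t e x
        * (starRingEnd ℂ) (vilenkin p (b * vilenkinPow p s) x)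
      = (starRingEnd ℂ) (vilenkin p (b * vilenkinPow p s) y) / vilenkinPow p s := by
  have : ∀ x, comb p s t e x * (starRingEnd ℂ) (vilenkin p (b * vilenkinPow p s) x)
      = (block p s t e).indicator (fun _ => (vilenkinPow p t : ℂ) / vilenkinPow p s
        * (starRingEnd ℂ) (vilenkin p (b * vilenkinPow p s) y)) x := by
    intro x
    rw [comb]
    by_cases hx : x ∈ block p s t e
    · rw [Set.indicator_of_mem hx, Set.indicator_of_mem hx,
        vilenkin_congr_block hp (fun k hk hk' => (hx k hk hk').trans (hy k hk hk').symm) hb]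
    · rw [Set.indicator_of_notMem hx, Set.indicator_of_notMem hx, zero_mul]
  simp only [this]
  rw [integral_indicator_const _ (measurableSet_block _ _ _), Measure.real,
    Measure.restrict_apply (measurableSet_block _ _ _), Set.inter_comm, ← Measure.real,
    volume_block_inter hp hd he hst, Complex.real_smul]
  have h3 : (vilenkinPow p t : ℂ) ≠ 0 := by exact_mod_cast (pow_pos_real hp t).ne'
  push_cast
  field_simp

/-- Multiplication by the comb copies the first `vilenkinPow p s` coefficients of `F` into each
later block of that length, up to a unimodular factor. -/
theorem systemCoeff_mul_comb (hp : ∀ k, 2 ≤ p k) {e : ℕ → ℕ} (he : ∀ k, e k < p k)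
    {s t b i : ℕ} (hst : s ≤ t) (hb : b * vilenkinPow p s < vilenkinPow p t)
    (hi : i < vilenkinPow p s) {y : unitInterval} (hy : y ∈ block p s t e)
    {F : unitInterval → ℂ} (hF : IsLevel p s F) :
    systemCoeff (vilenkin p) (fun x => F x * comb p s t e x) (i + b * vilenkinPow p s)
      = (starRingEnd ℂ) (vilenkin p (b * vilenkinPow p s) y) * systemCoeff (vilenkin p) F i := by
  have h1 : ∀ x, F x * comb p s t e x
        * (starRingEnd ℂ) (vilenkin p (i + b * vilenkinPow p s) x)
      = (F x * (starRingEnd ℂ) (vilenkin p i x)) * (comb p s t e x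
        * (starRingEnd ℂ) (vilenkin p (b * vilenkinPow p s) x)) := by
    intro x
    rw [vilenkin_add hp hi, map_mul]
    ring
  simp only [systemCoeff, h1]
  rw [(hF.mul (isLevel_vilenkin hp hi).conj).integral_mul hp
    (integrable_mul_conj_vilenkin ((isLevel_comb s t e).integrable hp) _)
    (fun d hd => setIntegral_comb_mul_conj hp hd he hst hb hy)]
  have h3 : (vilenkinPow p s : ℂ) ≠ 0 := by exact_mod_cast (pow_pos_real hp s).ne'
  field_simp

/-- The `q` complete blocks each reproduce `F x` times a character and add up to a kernel; the last,
incomplete block gives a rotated partial sum of `F`. -/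
theorem systemPartialSum_mul_comb (hp : ∀ k, 2 ≤ p k) {e : ℕ → ℕ} (he : ∀ k, e k < p k)
    {s t q r : ℕ} (hst : s ≤ t) (hr : r < vilenkinPow p s)
    (hq : q * vilenkinPow p s < vilenkinPow p t) {y : unitInterval} (hy : y ∈ block p s t e)
    {F : unitInterval → ℂ} (hF : IsLevel p s F) (x : unitInterval) :
    systemPartialSum (vilenkin p) (fun x => F x * comb p s t e x) (q * vilenkinPow p s + r) x
      = kernel p s q x y * F x
        + vilenkin p (q * vilenkinPow p s) x
          * (starRingEnd ℂ) (vilenkin p (q * vilenkinPow p s) y)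
          * systemPartialSum (vilenkin p) F r x := by
  have h1 : ∀ b i, b * vilenkinPow p s < vilenkinPow p t → i < vilenkinPow p s →
      systemCoeff (vilenkin p) (fun x => F x * comb p s t e x) (i + b * vilenkinPow p s)
        * vilenkin p (i + b * vilenkinPow p s) x
      = vilenkin p (b * vilenkinPow p s) x
          * (starRingEnd ℂ) (vilenkin p (b * vilenkinPow p s) y)
          * (systemCoeff (vilenkin p) F i * vilenkin p i x) := by
    intro b i hb hi
    rw [systemCoeff_mul_comb hp he hst hb hi hy hF, vilenkin_add hp hi]
    ring
  rw [systemPartialSum, Finset.sum_range_add, sum_range_mul]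
  congr 1
  · rw [← hF.systemPartialSum_pow hp x, kernel, Finset.sum_mul]
    refine Finset.sum_congr rfl fun b hb => ?_
    rw [systemPartialSum, Finset.mul_sum]
    refine Finset.sum_congr rfl fun i hi => ?_
    refine h1 b i ?_ (Finset.mem_range.1 hi)
    exact (Nat.mul_le_mul_right _ (Finset.mem_range.1 hb).le).trans_lt hq
  · rw [systemPartialSum, Finset.mul_sum]
    refine Finset.sum_congr rfl fun i hi => ?_
    rw [add_comm]
    exact h1 q i hq ((Finset.mem_range.1 hi).trans hr)

theorem systemPartialSum_indicator_block (hp : ∀ k, 2 ≤ p k) {d : ℕ → ℕ} (hd : ∀ k, d k < p k)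
    {m r : ℕ} (hr : r ≤ vilenkinPow p m) {y : unitInterval} (hy : y ∈ block p 0 m d) (a : ℂ)
    (x : unitInterval) :
    systemPartialSum (vilenkin p) ((block p 0 m d).indicator fun _ => a) r x
      = a / vilenkinPow p m * kernel p 0 r x y := by
  rw [systemPartialSum, kernel, Finset.mul_sum]
  refine Finset.sum_congr rfl fun n hn => ?_
  rw [pow_zero, mul_one]
  have : ∀ t, (block p 0 m d).indicator (fun _ => a) t * (starRingEnd ℂ) (vilenkin p n t)
      = (block p 0 m d).indicator (fun _ => a * (starRingEnd ℂ) (vilenkin p n y)) t := by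
    intro t
    by_cases ht : t ∈ block p 0 m d
    · rw [Set.indicator_of_mem ht, Set.indicator_of_mem ht, vilenkin_congr hp (fun k hk =>
        (ht k (Nat.zero_le k) hk).trans (hy k (Nat.zero_le k) hk).symm)
        ((Finset.mem_range.1 hn).trans_le hr)]
    · rw [Set.indicator_of_notMem ht, Set.indicator_of_notMem ht, zero_mul]
  simp only [systemCoeff, this]
  rw [integral_indicator_const _ (measurableSet_block _ _ _), volume_block_zero hp hd,
    Complex.real_smul]
  push_cast
  ring

theorem tendsto_pow_atTop (hp : ∀ k, 2 ≤ p k) :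
    Tendsto (fun k => (vilenkinPow p k : ℝ)) atTop atTop :=
  tendsto_natCast_atTop_atTop.comp
    (tendsto_atTop_mono (fun k => (lt_pow hp k).le) tendsto_id)

/-- A large kernel forces `x` to share the digits of `y` at the places in `[s, K)`. The inequality
on `K` bounds the measure of that set by a multiple of `1 / R`; it loses the factor `M` in passing
from `k + 1` to `k`, which is where bounded type enters. -/
theorem exists_block_of_lt_norm_kernel (hp : ∀ k, 2 ≤ p k) {M : ℕ} (hM : ∀ k, p k ≤ M) (s : ℕ)
    (y : unitInterval) (R : ℝ) :
    ∃ K, s ≤ K ∧ R * vilenkinPow p s < M * vilenkinPow p K ∧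
      ∀ x q, R < ‖kernel p s q x y‖ → x ∈ block p s K fun k => vilenkinDigit p k y := by
  have hM0 : (0 : ℝ) < M := by
    have := (hp 0).trans (hM 0)
    exact_mod_cast (by omega : 0 < M)
  have hex : ∃ K, R * vilenkinPow p s < M * vilenkinPow p K :=
    (((tendsto_pow_atTop hp).const_mul_atTop hM0).eventually_gt_atTop _).exists
  classical
  have hspec := Nat.find_spec hex
  refine ⟨max s (Nat.find hex), le_max_left _ _, hspec.trans_le ?_, ?_⟩
  · gcongr
    exact_mod_cast pow_le_pow hp (le_max_right _ _)
  · intro x q hR k hk hk'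
    by_contra hne
    have h1 := hR.trans_le (norm_kernel_le hp hk hne q)
    rw [lt_div_iff₀ (pow_pos_real hp s), pow_succ] at h1
    have h2 : k < Nat.find hex := by
      rcases lt_max_iff.1 hk' with h | h
      · omega
      · exact h
    refine Nat.find_min hex h2 (h1.trans_le ?_)
    push_cast
    rw [mul_comm]
    gcongr
    exact_mod_cast hM k

/-- The constant `a` on an interval of level `m`, corrected on the points with the digits `e` at
the places in `[s, t)` so that all its coefficients of index less than `vilenkinPow p s` vanish. -/
noncomputable def atom (p : ℕ → ℕ) (a : ℂ) (m : ℕ) (d : ℕ → ℕ) (s t : ℕ) (e : ℕ → ℕ)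
    (x : unitInterval) : ℂ :=
  (block p 0 m d).indicator (fun _ => a) x
    - (block p 0 m d).indicator (fun _ => a) x * comb p s t e x

/-! ### Spectrum, norm and maximal function of an atom -/

section Atom

variable {a : ℂ} {m s t : ℕ} {d e : ℕ → ℕ}

theorem isLevel_atom (hms : m ≤ s) (hst : s ≤ t) : IsLevel p t (atom p a m d s t e) := by
  have h1 := (isLevel_indicator_block (p := p) 0 m d a).mono (hms.trans hst)
  intro x y hxy
  simp only [atom, h1 x y hxy, isLevel_comb s t e x y hxy]

theorem integrable_indicator_block_mul_comb (hp : ∀ k, 2 ≤ p k) (hms : m ≤ s) (hst : s ≤ t) :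
    Integrable fun x => (block p 0 m d).indicator (fun _ => a) x * comb p s t e x :=
  (((isLevel_indicator_block 0 m d a).mono (hms.trans hst)).mul (isLevel_comb s t e)).integrable hp

theorem atom_apply_of_notMem {x : unitInterval} (hx : x ∉ block p s t e) :
    atom p a m d s t e x = (block p 0 m d).indicator (fun _ => a) x := by
  rw [atom, comb, Set.indicator_of_notMem hx, mul_zero, sub_zero]

theorem atom_im (ha : a.im = 0) (x : unitInterval) : (atom p a m d s t e x).im = 0 := by
  have h1 : ∀ x, ((block p 0 m d).indicator (fun _ => a) x).im = 0 := by
    intro x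
    by_cases hx : x ∈ block p 0 m d <;> simp [hx, ha]
  have h2 : (comb p s t e x).im = 0 := by
    rw [comb]
    by_cases hx : x ∈ block p s t e
    · rw [Set.indicator_of_mem hx]
      rw [← Complex.ofReal_natCast, ← Complex.ofReal_natCast, ← Complex.ofReal_div,
        Complex.ofReal_im]
    · rw [Set.indicator_of_notMem hx]
      rfl
  simp [atom, h1, h2]

theorem exists_mem_block (hp : ∀ k, 2 ≤ p k) (he : ∀ k, e k < p k) (s t : ℕ) :
    ∃ y, y ∈ block p s t e := by
  obtain ⟨y, -, hy⟩ := exists_digits_eq hp he t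
  exact ⟨y, fun k _ hk => hy k hk⟩

/-- In block `b = 0` the comb copies the coefficients unchanged, so the subtraction cancels them. -/
theorem systemCoeff_atom_eq_zero_of_lt (hp : ∀ k, 2 ≤ p k) (he : ∀ k, e k < p k) (hms : m ≤ s)
    (hst : s ≤ t) {n : ℕ} (hn : n < vilenkinPow p s) :
    systemCoeff (vilenkin p) (atom p a m d s t e) n = 0 := by
  obtain ⟨y, hy⟩ := exists_mem_block hp he s t
  have hF := (isLevel_indicator_block (p := p) 0 m d a).mono hms
  have h := systemCoeff_mul_comb hp he hst (b := 0) (i := n)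
    (by simpa using pow_pos hp t) hn hy hF
  have h0 : vilenkin p 0 y = 1 := by simp [vilenkin]
  simp only [zero_mul, add_zero, h0, map_one, one_mul] at h
  unfold atom
  rw [systemCoeff_sub (hF.integrable hp) (integrable_indicator_block_mul_comb hp hms hst), h,
    sub_self]

theorem volume_block_inter_block (hp : ∀ k, 2 ≤ p k) (hd : ∀ k, d k < p k)
    (he : ∀ k, e k < p k) (hms : m ≤ s) (hst : s ≤ t) :
    volume.real (block p 0 m d ∩ block p s t e)
      = vilenkinPow p s / (vilenkinPow p m * vilenkinPow p t) := by
  have h := ((isLevel_indicator_block (p := p) 0 m d 1).mono hms).integral_mul hp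
    (w := (block p s t e).indicator fun _ => 1) (κ := 1 / vilenkinPow p t)
    ((isLevel_indicator_block s t e 1).integrable hp) (fun d' hd' => by
      rw [integral_indicator_const _ (measurableSet_block _ _ _), Measure.real,
        Measure.restrict_apply (measurableSet_block _ _ _), Set.inter_comm, ← Measure.real,
        volume_block_inter hp hd' he hst]
      simp)
  have h1 : ∀ x, (block p 0 m d).indicator (fun _ => (1 : ℂ)) x
      * (block p s t e).indicator (fun _ => 1) x
      = (block p 0 m d ∩ block p s t e).indicator (fun _ => 1) x := by
    intro x
    rw [← Set.inter_indicator_mul]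
    simp
  simp only [h1] at h
  rw [integral_indicator_const _ ((measurableSet_block _ _ _).inter (measurableSet_block _ _ _)),
    integral_indicator_const _ (measurableSet_block _ _ _), volume_block_zero hp hd] at h
  simp only [Complex.real_smul, mul_one] at h
  have h2 : volume.real (block p 0 m d ∩ block p s t e)
      = 1 / vilenkinPow p t * vilenkinPow p s * (1 / vilenkinPow p m) := by
    apply Complex.ofReal_injective
    rw [h]
    push_cast
    rfl
  rw [h2]
  field_simp

theorem integral_norm_atom_le (hp : ∀ k, 2 ≤ p k) (hd : ∀ k, d k < p k)
    (he : ∀ k, e k < p k) (hms : m ≤ s) (hst : s ≤ t) :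
    ∫ x, ‖atom p a m d s t e x‖ ≤ 2 * (‖a‖ / vilenkinPow p m) := by
  have hi1 : Integrable ((block p 0 m d).indicator fun _ => ‖a‖) :=
    (integrable_const _).indicator (measurableSet_block _ _ _)
  have hm2 := (measurableSet_block (p := p) 0 m d).inter (measurableSet_block (p := p) s t e)
  have hi2 : Integrable ((block p 0 m d ∩ block p s t e).indicator
      fun _ => ‖a‖ * ((vilenkinPow p t : ℝ) / vilenkinPow p s)) :=
    (integrable_const _).indicator hm2
  calc ∫ x, ‖atom p a m d s t e x‖
      ≤ ∫ x, ((block p 0 m d).indicator (fun _ => ‖a‖) x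
        + (block p 0 m d ∩ block p s t e).indicator
          (fun _ => ‖a‖ * ((vilenkinPow p t : ℝ) / vilenkinPow p s)) x) := by
        refine integral_mono ((isLevel_atom hms hst).integrable hp).norm (hi1.add hi2) fun x => ?_
        refine (norm_sub_le _ _).trans_eq ?_
        rw [norm_mul, comb, Set.inter_indicator_mul]
        simp [norm_indicator_eq_indicator_norm]
    _ = 2 * (‖a‖ / vilenkinPow p m) := by
        rw [integral_add hi1 hi2, integral_indicator_const _ (measurableSet_block _ _ _),
          integral_indicator_const _ hm2, volume_block_zero hp hd,
          volume_block_inter_block hp hd he hms hst]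
        have h1 := (pow_pos_real hp m).ne'
        have h2 := (pow_pos_real hp s).ne'
        have h3 := (pow_pos_real hp t).ne'
        simp only [smul_eq_mul]
        field_simp
        ring

theorem norm_systemPartialSum_atom_le (hp : ∀ k, 2 ≤ p k) (hd : ∀ k, d k < p k)
    (he : ∀ k, e k < p k) (hms : m ≤ s) (hst : s ≤ t) {y y' : unitInterval}
    (hy : y ∈ block p s t e) (hy' : y' ∈ block p 0 m d) {N : ℕ} (hN : vilenkinPow p s ≤ N)
    (hN' : N < vilenkinPow p t) (x : unitInterval) :
    ∃ q r, ‖systemPartialSum (vilenkin p) (atom p a m d s t e) N x‖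
      ≤ (block p 0 m d).indicator (fun _ => ‖a‖) x * (2 + ‖kernel p s q x y‖)
        + ‖a‖ / vilenkinPow p m * ‖kernel p 0 r x y'‖ := by
  have hF := isLevel_indicator_block (p := p) 0 m d a
  have hps := pow_pos hp s
  -- The remainder is capped at `vilenkinPow p m`: beyond it the partial sum of the indicator is the
  -- indicator itself, which accounts for one of the two units in the constant `2`.
  refine ⟨N / vilenkinPow p s, min (N % vilenkinPow p s) (vilenkinPow p m), ?_⟩
  have hq : N / vilenkinPow p s * vilenkinPow p s < vilenkinPow p t :=
    (Nat.div_mul_le_self _ _).trans_lt hN'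
  have hr := Nat.mod_lt N hps
  have hNe := Nat.div_add_mod N (vilenkinPow p s)
  rw [mul_comm] at hNe
  have h1 : systemPartialSum (vilenkin p) (atom p a m d s t e) N x
      = (block p 0 m d).indicator (fun _ => a) x
        - systemPartialSum (vilenkin p) (fun x => (block p 0 m d).indicator (fun _ => a) x
            * comb p s t e x) N x := by
    rw [← hF.systemPartialSum_eq hp ((pow_le_pow hp hms).trans hN) x]
    exact systemPartialSum_sub (hF.integrable hp) (integrable_indicator_block_mul_comb hp hms hst)
      N x
  have h2 := systemPartialSum_mul_comb hp he hst hr hq hy (hF.mono hms) x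
  rw [hNe] at h2
  rw [h1, h2]
  generalize N / vilenkinPow p s = q at *
  generalize N % vilenkinPow p s = r at *
  have hn : ‖(block p 0 m d).indicator (fun _ => a) x‖
      = (block p 0 m d).indicator (fun _ => ‖a‖) x := norm_indicator_eq_indicator_norm _ _
  have h3 : ‖systemPartialSum (vilenkin p) ((block p 0 m d).indicator fun _ => a) r x‖
      ≤ (block p 0 m d).indicator (fun _ => ‖a‖) x
        + ‖a‖ / vilenkinPow p m * ‖kernel p 0 (min r (vilenkinPow p m)) x y'‖ := by
    have hnn : 0 ≤ (block p 0 m d).indicator (fun _ => ‖a‖) x :=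
      Set.indicator_nonneg (fun _ _ => norm_nonneg a) x
    rcases le_total r (vilenkinPow p m) with h | h
    · rw [systemPartialSum_indicator_block hp hd h hy', min_eq_left h, norm_mul, norm_div,
        Complex.norm_natCast]
      linarith
    · rw [hF.systemPartialSum_eq hp h, hn]
      have : 0 ≤ ‖a‖ / vilenkinPow p m * ‖kernel p 0 (min r (vilenkinPow p m)) x y'‖ := by
        positivity
      linarith
  refine (norm_sub_le _ _).trans ?_
  refine (add_le_add_right (norm_add_le _ _) _).trans ?_
  simp only [norm_mul, RCLike.norm_conj, norm_vilenkin, one_mul]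
  rw [hn]
  linarith

/-- The weak type estimate for the maximal function of the partial sums of an atom. -/
theorem volume_maximal_atom_le (hp : ∀ k, 2 ≤ p k) {M : ℕ} (hM : ∀ k, p k ≤ M)
    (hd : ∀ k, d k < p k) (he : ∀ k, e k < p k) (hms : m ≤ s) (hst : s ≤ t) {c : ℝ} (hc : 0 < c) :
    volume.real {x | ∃ N, vilenkinPow p s ≤ N ∧ N < vilenkinPow p t ∧
        c < ‖systemPartialSum (vilenkin p) (atom p a m d s t e) N x‖}
      ≤ (6 + 6 * M) / c * (‖a‖ / vilenkinPow p m) := by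
  obtain ⟨y, hy⟩ := exists_mem_block hp he s t
  obtain ⟨y', hy'⟩ := exists_mem_block hp hd 0 m
  have hPm := pow_pos_real hp m
  have hPs := pow_pos_real hp s
  rcases (norm_nonneg a).eq_or_lt with ha | ha
  · rw [show {x | ∃ N, vilenkinPow p s ≤ N ∧ N < vilenkinPow p t ∧
        c < ‖systemPartialSum (vilenkin p) (atom p a m d s t e) N x‖} = ∅ from ?_,
      measureReal_empty]
    · positivity
    · rw [Set.eq_empty_iff_forall_notMem]
      rintro x ⟨N, hN, hN', hx⟩
      obtain ⟨q, r, h⟩ := norm_systemPartialSum_atom_le (a := a) hp hd he hms hst hy hy' hN hN' x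
      simp only [← ha, Set.indicator_zero, zero_mul, zero_div, add_zero] at h
      linarith
  -- The bound has three terms, `2‖a‖` on the interval and two kernel terms; one of them must exceed
  -- `c / 3`. The sets `A`, `B`, `C` below catch these cases, and the thresholds are `c / 3` divided
  -- by the coefficients of the kernels.
  obtain ⟨K, hK, hKR, hKx⟩ := exists_block_of_lt_norm_kernel hp hM s y (c / (3 * ‖a‖))
  obtain ⟨L, -, hLR, hLx⟩ := exists_block_of_lt_norm_kernel hp hM 0 y'
    (c * vilenkinPow p m / (3 * ‖a‖))
  have hPK := pow_pos_real hp K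
  have hPL := pow_pos_real hp L
  let A : Set unitInterval := {x | x ∈ block p 0 m d ∧ c < 6 * ‖a‖}
  let B : Set unitInterval := block p 0 m d ∩ block p s K fun k => vilenkinDigit p k y
  let C : Set unitInterval := block p 0 L fun k => vilenkinDigit p k y'
  have hsub : {x | ∃ N, vilenkinPow p s ≤ N ∧ N < vilenkinPow p t ∧
      c < ‖systemPartialSum (vilenkin p) (atom p a m d s t e) N x‖} ⊆ A ∪ B ∪ C := by
    rintro x ⟨N, hN, hN', hx⟩
    obtain ⟨q, r, h⟩ := norm_systemPartialSum_atom_le (a := a) hp hd he hms hst hy hy' hN hN' x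
    by_cases hC : x ∈ C
    · exact Or.inr hC
    have h1 : ‖a‖ / vilenkinPow p m * ‖kernel p 0 r x y'‖ ≤ c / 3 := by
      have := not_lt.1 fun h' => hC (hLx x r h')
      calc ‖a‖ / vilenkinPow p m * ‖kernel p 0 r x y'‖
          ≤ ‖a‖ / vilenkinPow p m * (c * vilenkinPow p m / (3 * ‖a‖)) := by gcongr
        _ = c / 3 := by field_simp
    left
    by_cases hD : x ∈ block p 0 m d
    · by_cases hB : x ∈ block p s K fun k => vilenkinDigit p k y
      · exact Or.inr ⟨hD, hB⟩
      have h2 : ‖a‖ * ‖kernel p s q x y‖ ≤ c / 3 := by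
        have := not_lt.1 fun h' => hB (hKx x q h')
        calc ‖a‖ * ‖kernel p s q x y‖ ≤ ‖a‖ * (c / (3 * ‖a‖)) := by gcongr
          _ = c / 3 := by field_simp
      rw [Set.indicator_of_mem hD] at h
      exact Or.inl ⟨hD, by linarith⟩
    · rw [Set.indicator_of_notMem hD, zero_mul] at h
      linarith
  have hA : volume.real A ≤ 6 / c * (‖a‖ / vilenkinPow p m) := by
    by_cases h : c < 6 * ‖a‖
    · have : A = block p 0 m d := by
        ext x
        exact ⟨fun hx => hx.1, fun hx => ⟨hx, h⟩⟩
      rw [this, volume_block_zero hp hd, div_mul_div_comm, div_le_div_iff₀ hPm (by positivity)]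
      nlinarith
    · have : A = ∅ := Set.eq_empty_iff_forall_notMem.2 fun x hx => h hx.2
      rw [this, measureReal_empty]
      positivity
  have hB : volume.real B ≤ 3 * M / c * (‖a‖ / vilenkinPow p m) := by
    rw [volume_block_inter_block hp hd (fun k => digit_lt hp k y) hms hK, div_mul_div_comm,
      div_le_div_iff₀ (by positivity) (by positivity)]
    rw [div_mul_eq_mul_div, div_lt_iff₀ (by positivity)] at hKR
    nlinarith
  have hC : volume.real C ≤ 3 * M / c * (‖a‖ / vilenkinPow p m) := by
    rw [volume_block_zero hp (fun k => digit_lt hp k y'), div_mul_div_comm,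
      div_le_div_iff₀ (by positivity) (by positivity)]
    rw [div_mul_eq_mul_div, div_lt_iff₀ (by positivity), pow_zero] at hLR
    push_cast at hLR
    nlinarith
  calc _ ≤ volume.real (A ∪ B ∪ C) := measureReal_mono hsub
    _ ≤ volume.real A + volume.real B + volume.real C :=
        (measureReal_union_le _ _).trans (add_le_add_left (measureReal_union_le _ _) _)
    _ ≤ (6 + 6 * M) / c * (‖a‖ / vilenkinPow p m) := by
        refine (add_le_add (add_le_add hA hB) hC).trans_eq ?_
        ring

end Atom

/-! ### Periodic families of intervals inside a dense open set -/

theorem abs_sub_lt_of_cylIndex_eq (hp : ∀ k, 2 ≤ p k) {m : ℕ} {x y : unitInterval}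
    (h : cylIndex p m x = cylIndex p m y) : |(x : ℝ) - y| < 1 / vilenkinPow p m := by
  have hP := pow_pos_real hp m
  have hx0 := Nat.floor_le (mul_nonneg hP.le x.2.1)
  have hx1 := Nat.lt_floor_add_one ((vilenkinPow p m : ℝ) * x)
  have hy0 := Nat.floor_le (mul_nonneg hP.le y.2.1)
  have hy1 := Nat.lt_floor_add_one ((vilenkinPow p m : ℝ) * y)
  simp only [cylIndex] at h
  rw [h] at hx0 hx1
  rw [lt_div_iff₀ hP]
  rw [show |(x : ℝ) - y| * vilenkinPow p m = |((x : ℝ) - y) * vilenkinPow p m| by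
    rw [abs_mul, abs_of_pos hP], abs_lt]
  constructor <;> nlinarith

theorem exists_ball_cylIndex_subset (hp : ∀ k, 2 ≤ p k) {r : ℝ} (hr : 0 < r) (m : ℕ) :
    ∃ k, m ≤ k ∧ ∀ x y : unitInterval, cylIndex p k x = cylIndex p k y → dist x y < r := by
  obtain ⟨k, hk, hk'⟩ := (((tendsto_pow_atTop hp).eventually_gt_atTop (1 / r)).and
    (eventually_ge_atTop m)).exists
  refine ⟨k, hk', fun x y h => ?_⟩
  rw [Subtype.dist_eq, Real.dist_eq]
  refine (abs_sub_lt_of_cylIndex_eq hp h).trans ?_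
  rwa [one_div_lt (pow_pos_real hp k) hr]

theorem exists_mem_cylIndex_eq_of_dense (hp : ∀ k, 2 ≤ p k) {G : Set unitInterval}
    (hGd : Dense G) {m j : ℕ} (hj : j < vilenkinPow p m) :
    ∃ x ∈ G, (x : ℝ) < 1 ∧ cylIndex p m x = j := by
  have hP := pow_pos_real hp m
  have hj' : (j : ℝ) + 1 ≤ vilenkinPow p m := by exact_mod_cast hj
  let O : Set unitInterval := (fun x : unitInterval => (x : ℝ)) ⁻¹'
      Set.Ioo ((j : ℝ) / vilenkinPow p m) (((j : ℝ) + 1) / vilenkinPow p m)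
  have hO : IsOpen O := isOpen_Ioo.preimage continuous_subtype_val
  have h1 : (j : ℝ) / vilenkinPow p m < ((j : ℝ) + 1 / 2) / vilenkinPow p m := by
    gcongr; linarith
  have h2 : ((j : ℝ) + 1 / 2) / vilenkinPow p m < ((j : ℝ) + 1) / vilenkinPow p m := by
    gcongr; linarith
  have h3 : ((j : ℝ) + 1) / vilenkinPow p m ≤ 1 := by rwa [div_le_one hP]
  obtain ⟨x, hxO, hxG⟩ := hGd.inter_open_nonempty O hO
    ⟨⟨((j : ℝ) + 1 / 2) / vilenkinPow p m, by positivity, (h2.trans_le h3).le⟩, h1, h2⟩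
  refine ⟨x, hxG, hxO.2.trans_le h3, ?_⟩
  rw [cylIndex, Nat.floor_eq_iff (mul_nonneg hP.le x.2.1), mul_comm]
  exact ⟨(div_le_iff₀ hP).1 hxO.1.le, (lt_div_iff₀ hP).1 hxO.2⟩

/-- A dense open set contains a periodic family of small intervals. -/
theorem exists_block_subset (hp : ∀ k, 2 ≤ p k) {G : Set unitInterval} (hGo : IsOpen G)
    (hGd : Dense G) (s : ℕ) :
    ∃ t e, s < t ∧ (∀ k, e k < p k) ∧ ∀ x ∈ block p s t e, (x : ℝ) < 1 → x ∈ G := by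
  -- The intervals of level `s` are treated one at a time. Each step only prolongs the pattern on
  -- `[s, t)`, so the intervals already handled keep their pieces inside `G`.
  have key : ∀ J, J ≤ vilenkinPow p s → ∃ t e, s < t ∧ (∀ k, e k < p k) ∧
      ∀ x ∈ block p s t e, (x : ℝ) < 1 → cylIndex p s x < J → x ∈ G := by
    intro J
    induction J with
    | zero =>
      exact fun _ => ⟨s + 1, fun _ => 0, Nat.lt_succ_self s, fun k => two_pos.trans_le (hp k),
        fun x _ _ h => absurd h (Nat.not_lt_zero _)⟩
    | succ J ih =>
      intro hJ
      obtain ⟨t, e, hst, he, h⟩ := ih (by omega)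
      obtain ⟨z, hz, hzJ⟩ := exists_cylIndex_eq hp (m := s) (j := J) hJ
      -- The current pattern inside the `J`-th interval; density puts a point `x₀` of `G` there, and
      -- enough further digits of `x₀` confine the piece to a ball in `G`.
      obtain ⟨z', hz', hzd⟩ := exists_digits_eq hp
        (d := fun k => if k < s then vilenkinDigit p k z else e k) (fun k => by
          split_ifs
          · exact digit_lt hp k z
          · exact he k) t
      obtain ⟨x₀, hx₀G, hx₀1, hx₀⟩ := exists_mem_cylIndex_eq_of_dense hp hGd
        (cylIndex_lt hp t hz')
      rw [cylIndex_eq_iff hp t hx₀1 hz'] at hx₀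
      have hx₀d : ∀ k, k < t → vilenkinDigit p k x₀
          = if k < s then vilenkinDigit p k z else e k :=
        fun k hk => (hx₀ k hk).trans (hzd k hk)
      have hx₀J : cylIndex p s x₀ = J := by
        rw [← hzJ, cylIndex_eq_iff hp s hx₀1 hz]
        intro k hk
        rw [hx₀d k (hk.trans hst), if_pos hk]
      obtain ⟨r, hr, hball⟩ := Metric.isOpen_iff.1 hGo x₀ hx₀G
      obtain ⟨t', htt', ht'⟩ := exists_ball_cylIndex_subset hp hr t
      refine ⟨t', fun k => vilenkinDigit p k x₀, hst.trans_le htt',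
        fun k => digit_lt hp k x₀, fun x hx hx1 hxJ => ?_⟩
      rcases Nat.lt_succ_iff_lt_or_eq.1 hxJ with hxJ | hxJ
      · refine h x (fun k hk hk' => ?_) hx1 hxJ
        refine (hx k hk (hk'.trans_le htt')).trans ?_
        exact (hx₀d k hk').trans (if_neg (not_lt.2 hk))
      · refine hball (ht' x x₀ ((cylIndex_eq_iff hp t' hx1 hx₀1).2 fun k hk => ?_))
        rcases lt_or_ge k s with hks | hks
        · exact (cylIndex_eq_iff hp s hx1 hx₀1).1 (hxJ.trans hx₀J.symm) k hks
        · exact hx k hks hk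
  obtain ⟨t, e, hst, he, h⟩ := key _ le_rfl
  exact ⟨t, e, hst, he, fun x hx hx1 => h x hx hx1 (cylIndex_lt hp s hx1)⟩

/-! ### Series absolutely convergent in `L¹` -/

section Series

variable {α E : Type*} [MeasurableSpace α] {μ : Measure α} [NormedAddCommGroup E]

theorem tsum_lintegral_enorm_ne_top {u : ℕ → α → E} (hu : ∀ k, Integrable (u k) μ)
    (hs : Summable fun k => ∫ x, ‖u k x‖ ∂μ) : ∑' k, ∫⁻ x, ‖u k x‖ₑ ∂μ ≠ ⊤ := by
  have : ∀ k, ∫⁻ x, ‖u k x‖ₑ ∂μ = ENNReal.ofReal (∫ x, ‖u k x‖ ∂μ) := fun k =>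
    (ofReal_integral_norm_eq_lintegral_enorm (hu k)).symm
  simp only [this]
  exact hs.tsum_ofReal_ne_top

theorem ae_summable_norm {u : ℕ → α → E} (hu : ∀ k, Integrable (u k) μ)
    (hs : Summable fun k => ∫ x, ‖u k x‖ ∂μ) : ∀ᵐ x ∂μ, Summable fun k => ‖u k x‖ := by
  have h := tsum_lintegral_enorm_ne_top hu hs
  rw [← lintegral_tsum fun k => (hu k).1.enorm] at h
  filter_upwards [ae_lt_top' (AEMeasurable.tsum fun k => (hu k).1.enorm) h] with x hx
  have h1 : ∑' k, ((‖u k x‖₊ : NNReal) : ENNReal) ≠ ⊤ := hx.ne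
  exact NNReal.summable_coe.2 (ENNReal.tsum_coe_ne_top_iff_summable.1 h1)

theorem integrable_of_hasSum [CompleteSpace E] {u : ℕ → α → E} {g : α → E}
    (hu : ∀ k, Integrable (u k) μ) (hs : Summable fun k => ∫ x, ‖u k x‖ ∂μ)
    (hg : ∀ᵐ x ∂μ, HasSum (fun k => u k x) (g x)) : Integrable g μ := by
  refine ⟨aestronglyMeasurable_of_tendsto_ae atTop
    (f := fun (n : ℕ) x => ∑ k ∈ Finset.range n, u k x) (fun n => ?_) ?_, ?_⟩
  · exact (integrable_finsetSum _ fun k _ => hu k).1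
  · filter_upwards [hg] with x hx
    exact hx.tendsto_sum_nat
  · have h := tsum_lintegral_enorm_ne_top hu hs
    rw [← lintegral_tsum fun k => (hu k).1.enorm] at h
    refine lt_of_le_of_lt (lintegral_mono_ae ?_) h.lt_top
    filter_upwards [hg, ae_summable_norm hu hs] with x hx hx'
    rw [← hx.tsum_eq]
    have h1 := nnnorm_tsum_le (f := fun k => u k x) (NNReal.summable_coe.1 hx')
    have h2 : ((‖∑' k, u k x‖₊ : NNReal) : ENNReal) ≤ ∑' k, ((‖u k x‖₊ : NNReal) : ENNReal) := by
      rw [← ENNReal.coe_tsum (NNReal.summable_coe.1 hx')]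
      exact_mod_cast h1
    exact h2

end Series

/-! ### Expansion of an integrable function into interval indicators -/

variable {E : Type*} [NormedAddCommGroup E]

theorem integrable_comp_cylIndex (hp : ∀ k, 2 ≤ p k) (m : ℕ) (φ : ℕ → E) :
    Integrable fun x => φ (cylIndex p m x) := by
  refine Integrable.of_bound (C := ∑ j ∈ Finset.range (vilenkinPow p m), ‖φ j‖)
    ((StronglyMeasurable.of_discrete (f := φ)).comp_measurable
      (measurable_cylIndex m)).aestronglyMeasurable ?_
  filter_upwards [ae_lt_one] with x hx
  exact Finset.single_le_sum (f := fun j => ‖φ j‖) (fun j _ => norm_nonneg _)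
    (Finset.mem_range.2 (cylIndex_lt hp m hx))

theorem integral_norm_comp_cylIndex (hp : ∀ k, 2 ≤ p k) (m : ℕ) (φ : ℕ → E) :
    ∫ x, ‖φ (cylIndex p m x)‖ = ∑ j ∈ Finset.range (vilenkinPow p m), ‖φ j‖ / vilenkinPow p m := by
  rw [integral_eq_sum_cylIndex hp m (integrable_comp_cylIndex hp m φ).norm]
  refine Finset.sum_congr rfl fun j hj => ?_
  have : ∀ x ∈ {x | cylIndex p m x = j}, ‖φ (cylIndex p m x)‖ = ‖φ j‖ := fun x hx => by
    rw [show cylIndex p m x = j from hx]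
  have hj' : MeasurableSet {x | cylIndex p m x = j} :=
    measurable_cylIndex m (measurableSet_singleton j)
  rw [setIntegral_congr_fun hj' this,
    setIntegral_const, volume_cylIndex_eq hp (Finset.mem_range.1 hj), smul_eq_mul]
  ring

variable [NormedSpace ℝ E]

theorem exists_integral_norm_sub_comp_cylIndex_le (hp : ∀ k, 2 ≤ p k) {h : unitInterval → E}
    (hh : Integrable h) {ε : ℝ} (hε : 0 < ε) :
    ∃ (m : ℕ) (φ : ℕ → E), ∫ x, ‖h x - φ (cylIndex p m x)‖ ≤ ε := by
  obtain ⟨g, hg, hgi⟩ := hh.exists_boundedContinuous_integral_sub_le (half_pos hε)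
  obtain ⟨δ, hδ, hgδ⟩ := Metric.uniformContinuous_iff.1
    (CompactSpace.uniformContinuous_of_continuous g.continuous) (ε / 2) (half_pos hε)
  obtain ⟨m, -, hm⟩ := exists_ball_cylIndex_subset hp hδ 0
  choose! y hy1 hy using fun j => exists_cylIndex_eq (m := m) (j := j) hp
  refine ⟨m, fun j => g (y j), ?_⟩
  calc ∫ x, ‖h x - g (y (cylIndex p m x))‖ ≤ ∫ x, (‖h x - g x‖ + ε / 2) := by
        refine integral_mono_ae (hh.sub (integrable_comp_cylIndex hp m fun j => g (y j))).norm
          ((hh.sub hgi).norm.add (integrable_const _)) ?_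
        filter_upwards [ae_lt_one] with x hx
        have h1 := hgδ (hm x (y (cylIndex p m x)) (hy _ (cylIndex_lt hp m hx)).symm)
        rw [dist_eq_norm] at h1
        have h2 := norm_add_le (h x - g x) (g x - g (y (cylIndex p m x)))
        rw [sub_add_sub_cancel] at h2
        linarith
    _ ≤ ε := by
        have h1 : Integrable fun x => ‖h x - g x‖ := (hh.sub hgi).norm
        rw [integral_add h1 (integrable_const _)]
        simp
        linarith

theorem exists_hasSum_comp_cylIndex (hp : ∀ k, 2 ≤ p k) {f : unitInterval → E}
    (hf : Integrable f) :
    ∃ (m : ℕ → ℕ) (φ : ℕ → ℕ → E),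
      (Summable fun k => ∫ x, ‖φ k (cylIndex p (m k) x)‖) ∧
      ∀ᵐ x, HasSum (fun k => φ k (cylIndex p (m k) x)) (f x) := by
  choose m φ hφ using fun (r : {r : unitInterval → E // Integrable r}) (k : ℕ) =>
    exists_integral_norm_sub_comp_cylIndex_le hp r.2 (ε := (1 / 2) ^ k) (by positivity)
  -- The remainder after `k` successive step-function approximations, the one at stage `k` having
  -- `L¹` error at most `(1 / 2) ^ k`.
  let r : ℕ → {r : unitInterval → E // Integrable r} := fun k => Nat.rec ⟨f, hf⟩
    (fun k r => ⟨fun x => r.1 x - φ r k (cylIndex p (m r k) x),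
      r.2.sub (integrable_comp_cylIndex hp _ _)⟩) k
  have hr : ∀ k x, (r (k + 1)).1 x = (r k).1 x - φ (r k) k (cylIndex p (m (r k) k) x) :=
    fun k x => rfl
  have hrs : Summable fun k => ∫ x, ‖(r k).1 x‖ := by
    rw [← summable_nat_add_iff 1]
    exact Summable.of_nonneg_of_le (fun k => integral_nonneg fun x => norm_nonneg _)
      (fun k => hφ (r k) k) summable_geometric_two
  have hs : Summable fun k => ∫ x, ‖φ (r k) k (cylIndex p (m (r k) k) x)‖ := by
    refine Summable.of_nonneg_of_le (fun k => integral_nonneg fun x => norm_nonneg _) (fun k => ?_)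
      (hrs.add ((summable_nat_add_iff 1).2 hrs))
    rw [← integral_add (r k).2.norm (r (k + 1)).2.norm]
    refine integral_mono (integrable_comp_cylIndex hp _ _).norm
      ((r k).2.norm.add (r (k + 1)).2.norm) fun x => ?_
    have h2 := norm_sub_le ((r k).1 x) ((r (k + 1)).1 x)
    rwa [hr, sub_sub_cancel] at h2
  refine ⟨fun k => m (r k) k, fun k => φ (r k) k, hs, ?_⟩
  filter_upwards [ae_summable_norm (fun k => (r k).2) hrs,
    ae_summable_norm (fun k => integrable_comp_cylIndex hp _ _) hs] with x hx hx'
  have h0 : Tendsto (fun k => (r k).1 x) atTop (𝓝 0) :=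
    tendsto_zero_iff_norm_tendsto_zero.2 hx.tendsto_atTop_zero
  have hsum : ∀ n, ∑ k ∈ Finset.range n, φ (r k) k (cylIndex p (m (r k) k) x)
      = f x - (r n).1 x := by
    intro n
    induction n with
    | zero => simp [r]
    | succ n ih =>
      rw [Finset.sum_range_succ, ih, hr]
      abel
  refine hasSum_of_subseq_of_summable hx' tendsto_finset_range ?_
  simp only [hsum]
  simpa using tendsto_const_nhds.sub h0

/-- Each step function is split into its constant pieces, with zero coefficients for indices out of
range. At a point `x < 1` at most one piece per stage is nonzero, so the sum over pairs reduces to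
the sum over stages. -/
theorem exists_hasSum_indicator_block_prod (hp : ∀ k, 2 ≤ p k) {f : unitInterval → E}
    (hf : Integrable f) :
    ∃ (a : ℕ × ℕ → E) (m : ℕ × ℕ → ℕ) (d : ℕ × ℕ → ℕ → ℕ), (∀ i k, d i k < p k) ∧
      (Summable fun i => ‖a i‖ / vilenkinPow p (m i)) ∧
      ∀ᵐ x, HasSum (fun i => (block p 0 (m i) (d i)).indicator (fun _ => a i) x) (f x) := by
  obtain ⟨m, φ, hs, hae⟩ := exists_hasSum_comp_cylIndex hp hf
  choose! y hy1 hy using fun m j => exists_cylIndex_eq (m := m) (j := j) hp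
  obtain ⟨a, ha, ha0⟩ : ∃ a : ℕ × ℕ → E, (∀ k j, j < vilenkinPow p (m k) → a (k, j) = φ k j) ∧
      ∀ k j, ¬ j < vilenkinPow p (m k) → a (k, j) = 0 :=
    ⟨fun z => if z.2 < vilenkinPow p (m z.1) then φ z.1 z.2 else 0,
      fun k j h => if_pos h, fun k j h => if_neg h⟩
  refine ⟨a, fun z => m z.1, fun z k => vilenkinDigit p k (y (m z.1) z.2),
    fun i k => digit_lt hp k _, ?_, ?_⟩
  · have h0 : ∀ k, ∀ j ∉ Finset.range (vilenkinPow p (m k)),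
        ‖a (k, j)‖ / vilenkinPow p (m k) = 0 := by
      intro k j hj
      rw [ha0 k j fun h => hj (Finset.mem_range.2 h), norm_zero, zero_div]
    rw [summable_prod_of_nonneg fun z => by positivity]
    refine ⟨fun k => summable_of_ne_finset_zero (h0 k), ?_⟩
    refine hs.congr fun k => ?_
    rw [integral_norm_comp_cylIndex hp]
    refine Eq.trans ?_ (tsum_eq_sum (h0 k)).symm
    refine Finset.sum_congr rfl fun j hj => ?_
    rw [ha k j (Finset.mem_range.1 hj)]
  · filter_upwards [hae, ae_lt_one] with x hx hx1
    have hinj : Function.Injective fun k => (k, cylIndex p (m k) x) :=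
      fun k l hkl => congrArg Prod.fst hkl
    have hmem : ∀ k j, j < vilenkinPow p (m k) →
        (x ∈ block p 0 (m k) (fun i => vilenkinDigit p i (y (m k) j))
          ↔ cylIndex p (m k) x = j) := by
      intro k j hj
      have h1 := cylIndex_eq_iff hp (m k) hx1 (hy1 _ _ hj)
      rw [hy _ _ hj] at h1
      rw [h1]
      exact ⟨fun h i hi => h i (Nat.zero_le i) hi, fun h i _ hi => h i hi⟩
    refine (hinj.hasSum_iff ?_).1 ?_
    · rintro ⟨k, j⟩ hz
      by_cases hj : j < vilenkinPow p (m k)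
      · refine Set.indicator_of_notMem (fun h => hz ⟨k, ?_⟩) _
        exact congrArg (Prod.mk k) ((hmem k j hj).1 h)
      · simp only [ha0 k j hj, Set.indicator_zero]
    · refine hx.congr_fun fun k => ?_
      have hlt := cylIndex_lt hp (m k) hx1
      rw [← ha k _ hlt]
      exact Set.indicator_of_mem ((hmem k _ hlt).2 rfl) fun _ => a (k, cylIndex p (m k) x)

/-- Every integrable function is an absolutely convergent series of multiples of indicator
functions of intervals. -/
theorem exists_hasSum_indicator_block (hp : ∀ k, 2 ≤ p k) {f : unitInterval → E}
    (hf : Integrable f) :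
    ∃ (a : ℕ → E) (m : ℕ → ℕ) (d : ℕ → ℕ → ℕ), (∀ i k, d i k < p k) ∧
      (Summable fun i => ‖a i‖ / vilenkinPow p (m i)) ∧
      ∀ᵐ x, HasSum (fun i => (block p 0 (m i) (d i)).indicator (fun _ => a i) x) (f x) := by
  obtain ⟨a, m, d, hd, hs, hae⟩ := exists_hasSum_indicator_block_prod hp hf
  have hκ : Nonempty (ℕ ≃ ℕ × ℕ) := ⟨Nat.pairEquiv.symm⟩
  obtain ⟨κ⟩ := hκ
  refine ⟨fun i => a (κ i), fun i => m (κ i), fun i => d (κ i), fun i k => hd (κ i) k,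
    (κ.summable_iff (f := fun i => ‖a i‖ / vilenkinPow p (m i))).2 hs, ?_⟩
  filter_upwards [hae] with x hx
  exact (κ.hasSum_iff (f := fun i => (block p 0 (m i) (d i)).indicator (fun _ => a i) x)).2 hx

/-- For real-valued `f` the expansion is applied to its real part, which keeps the coefficients
real. -/
theorem exists_hasSum_indicator_block_complex (hp : ∀ k, 2 ≤ p k) {f : unitInterval → ℂ}
    (hf : Integrable f) :
    ∃ (a : ℕ → ℂ) (m : ℕ → ℕ) (d : ℕ → ℕ → ℕ), (∀ i k, d i k < p k) ∧
      (Summable fun i => ‖a i‖ / vilenkinPow p (m i)) ∧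
      ((∀ x, (f x).im = 0) → ∀ i, (a i).im = 0) ∧
      ∀ᵐ x, HasSum (fun i => (block p 0 (m i) (d i)).indicator (fun _ => a i) x) (f x) := by
  by_cases him : ∀ x, (f x).im = 0
  · obtain ⟨a, m, d, hd, hs, hae⟩ := exists_hasSum_indicator_block hp hf.re
    refine ⟨fun i => a i, m, d, hd, by simpa using hs, fun _ i => Complex.ofReal_im _, ?_⟩
    filter_upwards [hae] with x hx
    have h := Complex.hasSum_ofReal.2 hx
    convert h using 2 with i
    · by_cases hi : x ∈ block p 0 (m i) (d i)
      · rw [Set.indicator_of_mem hi, Set.indicator_of_mem hi]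
      · rw [Set.indicator_of_notMem hi, Set.indicator_of_notMem hi, Complex.ofReal_zero]
    · exact Complex.ext (by simp) (by simp [him x])
  · obtain ⟨a, m, d, hd, hs, hae⟩ := exists_hasSum_indicator_block hp hf
    exact ⟨a, m, d, hd, hs, fun h => absurd h him, hae⟩

/-! ### Convergence of the assembled series -/

theorem hasSum_systemCoeff {u : ℕ → unitInterval → ℂ} {g : unitInterval → ℂ}
    (hu : ∀ i, Integrable (u i)) (hs : Summable fun i => ∫ x, ‖u i x‖)
    (hg : ∀ᵐ x, HasSum (fun i => u i x) (g x)) (n : ℕ) :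
    HasSum (fun i => systemCoeff (vilenkin p) (u i) n) (systemCoeff (vilenkin p) g n) := by
  have h := hasSum_integral_of_summable_integral_norm
    (fun i => integrable_mul_conj_vilenkin (p := p) (hu i) n)
    (by simpa [norm_vilenkin] using hs)
  rw [show systemCoeff (vilenkin p) g n
    = ∫ x, ∑' i, u i x * (starRingEnd ℂ) (vilenkin p n x) from ?_]
  · exact h
  refine integral_congr_ae ?_
  filter_upwards [hg] with x hx
  exact (hx.mul_right _).tsum_eq.symm

/-- A series of functions with consecutive spectra whose maximal functions tend to zero in the
appropriate sense has an almost everywhere convergent Fourier series. -/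
theorem fourierSeriesConvergesAE_of_hasSum (hp : ∀ k, 2 ≤ p k) {u : ℕ → unitInterval → ℂ}
    {g : unitInterval → ℂ} {s t : ℕ → ℕ} (hst : ∀ i, s i < t i) (hts : ∀ i, t i ≤ s (i + 1))
    (hu : ∀ i, Integrable (u i)) (hs : Summable fun i => ∫ x, ‖u i x‖)
    (hg : ∀ᵐ x, HasSum (fun i => u i x) (g x))
    (hlow : ∀ i n, n < vilenkinPow p (s i) → systemCoeff (vilenkin p) (u i) n = 0)
    (hhigh : ∀ i N x, vilenkinPow p (t i) ≤ N → systemPartialSum (vilenkin p) (u i) N x = u i x)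
    (hweak : ∀ c : ℝ, 0 < c → Summable fun i => volume.real {x | ∃ N, vilenkinPow p (s i) ≤ N ∧
      N < vilenkinPow p (t i) ∧ c < ‖systemPartialSum (vilenkin p) (u i) N x‖}) :
    FourierSeriesConvergesAE (vilenkin p) g := by
  have hsmono : StrictMono s := strictMono_nat_of_lt_succ fun i => (hst i).trans_le (hts i)
  have htmono : StrictMono t := strictMono_nat_of_lt_succ fun i => (hts i).trans_lt (hst (i + 1))
  have hts' : ∀ i j, i < j → t i ≤ s j := fun i j hij => (hts i).trans (hsmono.monotone hij)
  -- Borel–Cantelli, applied for each of the countably many thresholds `1 / (n + 1)`.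
  have hbad : ∀ n : ℕ, ∀ᵐ x, ∀ᶠ i in atTop, x ∉ {x | ∃ N, vilenkinPow p (s i) ≤ N ∧
      N < vilenkinPow p (t i) ∧
      1 / ((n : ℝ) + 1) < ‖systemPartialSum (vilenkin p) (u i) N x‖} := by
    intro n
    refine ae_eventually_notMem ?_
    have h := (hweak (1 / ((n : ℝ) + 1)) (by positivity)).tsum_ofReal_ne_top
    rwa [tsum_congr fun i => ofReal_measureReal (measure_ne_top _ _)] at h
  filter_upwards [hg, ae_all_iff.2 hbad] with x hx hxbad
  rw [Metric.tendsto_atTop]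
  intro ε hε
  obtain ⟨n, hn⟩ := exists_nat_one_div_lt (half_pos hε)
  obtain ⟨I, hI⟩ := eventually_atTop.1 ((hxbad n).and
    (Metric.tendsto_nhds.1 hx.tendsto_sum_nat (ε / 2) (half_pos hε)))
  refine ⟨vilenkinPow p (t I), fun N hN => ?_⟩
  have hex : ∃ j, N < vilenkinPow p (t j) :=
    ⟨N, (lt_pow hp N).trans_le (pow_le_pow hp htmono.le_apply)⟩
  classical
  -- The atom `j` is the only one that can be incomplete at `N`: earlier spectra end by `N`, later
  -- ones have not begun.
  obtain ⟨j, hj, hjmin⟩ : ∃ j, N < vilenkinPow p (t j) ∧ ∀ i < j, vilenkinPow p (t i) ≤ N :=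
    ⟨Nat.find hex, Nat.find_spec hex, fun i hi => not_lt.1 (Nat.find_min hex hi)⟩
  have hIj : I ≤ j := by
    by_contra h
    have := pow_le_pow hp (htmono.monotone (not_le.1 h).le)
    omega
  have hcoeff : ∀ k ∈ Finset.range N, systemCoeff (vilenkin p) g k
      = ∑ i ∈ Finset.range (j + 1), systemCoeff (vilenkin p) (u i) k := by
    intro k hk
    rw [← (hasSum_systemCoeff hu hs hg k).tsum_eq]
    refine tsum_eq_sum fun i hi => hlow i k ?_
    rw [Finset.mem_range, not_lt] at hi
    exact (Finset.mem_range.1 hk).trans (hj.trans_le (pow_le_pow hp (hts' j i hi)))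
  have hS : systemPartialSum (vilenkin p) g N x
      = ∑ i ∈ Finset.range j, u i x + systemPartialSum (vilenkin p) (u j) N x := by
    have : systemPartialSum (vilenkin p) g N x
        = ∑ i ∈ Finset.range (j + 1), systemPartialSum (vilenkin p) (u i) N x := by
      simp only [systemPartialSum]
      rw [Finset.sum_comm]
      refine Finset.sum_congr rfl fun k hk => ?_
      rw [hcoeff k hk, Finset.sum_mul]
    rw [this, Finset.sum_range_succ]
    congr 1
    exact Finset.sum_congr rfl fun i hi => hhigh i N x (hjmin i (Finset.mem_range.1 hi))
  have hact : ‖systemPartialSum (vilenkin p) (u j) N x‖ < ε / 2 := by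
    -- In the gap before `vilenkinPow p (s j)` the atom contributes nothing yet.
    rcases le_or_gt (vilenkinPow p (s j)) N with h | h
    · exact (not_lt.1 fun h' => (hI j hIj).1 ⟨N, h, hj, h'⟩).trans_lt hn
    · rw [systemPartialSum, Finset.sum_eq_zero, norm_zero]
      · exact half_pos hε
      · intro k hk
        rw [hlow j k ((Finset.mem_range.1 hk).trans h), zero_mul]
  have h2 := (hI j hIj).2
  rw [hS, dist_eq_norm, add_sub_right_comm]
  rw [dist_eq_norm] at h2
  exact (norm_add_le _ _).trans_lt (by linarith)

/-- An integrable function can be changed on a given dense open set so that its Fourier series in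
a Vilenkin system of bounded type converges almost everywhere. -/
theorem exists_fourierSeriesConvergesAE (hp : ∀ k, 2 ≤ p k) {M : ℕ} (hM : ∀ k, p k ≤ M)
    {f : unitInterval → ℂ} (hf : Integrable f) {G : Set unitInterval} (hGo : IsOpen G)
    (hGd : Dense G) :
    ∃ g : unitInterval → ℂ, Integrable g ∧ {x | g x ≠ f x} ⊆ G ∧
      ((∀ x, (f x).im = 0) → ∀ x, (g x).im = 0) ∧
      FourierSeriesConvergesAE (vilenkin p) g := by
  classical
  obtain ⟨a, m, d, hd, hsum, him, hae⟩ := exists_hasSum_indicator_block_complex hp hf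
  choose T e hT he hTG using exists_block_subset hp hGo hGd
  -- Each spectrum must start after the previous one ends, and no earlier than the level `m i` at
  -- which its interval is resolved.
  let s : ℕ → ℕ := fun i => Nat.rec (m 0) (fun i r => max (T r) (m (i + 1))) i
  have hs1 : ∀ i, s (i + 1) = max (T (s i)) (m (i + 1)) := fun i => rfl
  have hms : ∀ i, m i ≤ s i := by
    intro i
    cases i with
    | zero => exact le_rfl
    | succ i => exact (hs1 i).symm ▸ le_max_right _ _
  let u : ℕ → unitInterval → ℂ := fun i => atom p (a i) (m i) (d i) (s i) (T (s i)) (e (s i))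
  have hu : ∀ i, Integrable (u i) := fun i => (isLevel_atom (hms i) (hT _).le).integrable hp
  have hus : Summable fun i => ∫ x, ‖u i x‖ :=
    Summable.of_nonneg_of_le (fun i => integral_nonneg fun x => norm_nonneg _)
      (fun i => integral_norm_atom_le hp (hd i) (he _) (hms i) (hT _).le) (hsum.mul_left 2)
  -- Setting `g = f` off `G` at every point makes the inclusion in `G` exact, including at `1` and
  -- at points where the series diverges.
  let g : unitInterval → ℂ := fun x => if x ∈ G then ∑' i, u i x else f x
  have hg : ∀ᵐ x, HasSum (fun i => u i x) (g x) := by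
    filter_upwards [hae, ae_lt_one, ae_summable_norm hu hus] with x hx hx1 hxs
    by_cases hxG : x ∈ G
    · simp only [g, if_pos hxG]
      exact hxs.of_norm.hasSum
    · simp only [g, if_neg hxG]
      convert hx using 2 with i
      exact atom_apply_of_notMem fun h => hxG (hTG _ x h hx1)
  refine ⟨g, integrable_of_hasSum hu hus hg, fun x hx => ?_, fun hreal x => ?_, ?_⟩
  · by_contra hxG
    exact hx (if_neg hxG)
  · by_cases hxG : x ∈ G
    · simp only [g, if_pos hxG]
      have : ∀ i, u i x = ((u i x).re : ℂ) := fun i =>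
        Complex.ext rfl (by simpa using atom_im (him hreal i) x)
      rw [tsum_congr this, ← Complex.ofReal_tsum, Complex.ofReal_im]
    · simp only [g, if_neg hxG]
      exact hreal x
  · refine fourierSeriesConvergesAE_of_hasSum hp (s := s) (t := fun i => T (s i))
      (fun i => hT (s i)) (fun i => (hs1 i).symm ▸ le_max_left _ _) hu hus hg
      (fun i n hn => systemCoeff_atom_eq_zero_of_lt hp (he _) (hms i) (hT _).le hn)
      (fun i N x hN => (isLevel_atom (hms i) (hT _).le).systemPartialSum_eq hp hN x)
      (fun c hc => ?_)
    exact Summable.of_nonneg_of_le (fun i => measureReal_nonneg)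
      (fun i => volume_maximal_atom_le hp hM (hd i) (he _) (hms i) (hT _).le hc)
      (hsum.mul_left _)

end Vilenkin

theorem corollary1 (f : unitInterval → ℂ) (hf : Integrable f)
    (G : Set unitInterval) (hGo : IsOpen G) (hGd : Dense G) :
    (∃ g : unitInterval → ℂ, Integrable g ∧ {x | g x ≠ f x} ⊆ G ∧
      ((∀ x, (f x).im = 0) → ∀ x, (g x).im = 0) ∧
      FourierSeriesConvergesAE walsh g) ∧
    (∀ p : ℕ → ℕ, (∀ k, 2 ≤ p k) → (∃ M, ∀ k, p k ≤ M) →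
      ∃ g : unitInterval → ℂ, Integrable g ∧ {x | g x ≠ f x} ⊆ G ∧
        ((∀ x, (f x).im = 0) → ∀ x, (g x).im = 0) ∧
        FourierSeriesConvergesAE (vilenkin p) g) := by
  refine ⟨?_, fun p hp ⟨M, hM⟩ => Vilenkin.exists_fourierSeriesConvergesAE hp hM hf hGo hGd⟩
  rw [Vilenkin.walsh_eq_vilenkin]
  exact Vilenkin.exists_fourierSeriesConvergesAE (fun _ => le_rfl) (fun _ => le_rfl) hf hGo hGd
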